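/- **Setting.** Tensors are real third-order tensors; sums and scalar multiples are entrywise. For $\mathcal A\in\mathbb R^{N_1\times N_2\times N_3}$ with frontal slices $A_1,\dots,A_{N_3}$, $\mathrm{bcirc}(\mathcal A)\in\mathbb R^{N_1N_3\times N_2N_3}$ is the block circulant matrix whose $(p,q)$ block is $A_{1+((p-q)\bmod N_3)}$, and $\mathrm{unfold}(\mathcal A)$ is the matrix obtained by stacking $A_1,\dots,A_{N_3}$ vertically, with inverse $\mathrm{fold}$. The t-product is $\mathcal A*\mathcal B=\mathrm{fold}(\mathrm{bcirc}(\mathcal A)\,\mathrm{unfold}(\mathcal B))$; $\mathcal A^\top$ is obtained by transposing every frontal slice and reversing the order of slices $2,\dots,N_3$; $\mathcal A^\dagger$ is the tensor with $\mathrm{bcirc}(\mathcal A^\dagger)=\mathrm{bcirc}(\mathcal A)^\dagger$ (Moore–Penrose pseudoinverse). Let $\langle\mathcal X,\mathcal Y\rangle=\sum_{i,j,k}\mathcal X_{ijk}\mathcal Y_{ijk}$, $\|\mathcal X\|_F=\sqrt{\langle\mathcal X,\mathcal X\rangle}$, $\|\mathcal X\|_1=\sum_{i,j,k}|\mathcal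 X_{ijk}|$, $\|\mathcal X\|_2=\|\mathrm{bcirc}(\mathcal X)\|_2$ (spectral norm), and $\mathrm{ran}_K(\mathcal A^\top)=\{\mathcal A^\top*\mathcal W:\mathcal W\in\mathbb R^{N_1\times K\times N_3}\}$. Write $\mathcal A_{i,:,:}\in\mathbb R^{1\times N_2\times N_3}$ and $\mathcal A_{:,j,:}\in\mathbb R^{N_1\times1\times N_3}$ for the horizontal and lateral slices, and $\sigma_{\min}(M)$ for the smallest nonzero singular value of a matrix $M$. Let $0\ne\mathcal A\in\mathbb R^{N_1\times N_2\times N_3}$, $\mathcal B\in\mathbb R^{N_1\times K\times N_3}$, $\lambda\ge0$, and $f(\mathcal X)=\frac12\|\mathcal X\|_F^2+\lambda\|\mathcal X\|_1$ on $\mathbb R^{N_2\times K\times N_3}$. Let $\partial f(\mathcal X)$ be the subdifferential and, for $\mathcal Z\in\partial f(\mathcal X)$, let $D_{f,\mathcal Z}(\mathcal X,\mathcal Y)=f(\mathcal Y)-f(\mathcal X)-\langle\mathcal Z,\mathcal Y-\mathcal X\rangle$ be the Bregman distance. Put $$\lambda_r=\max_i\frac{\|\mathcal A_{i,:,:}\|_2^2}{\|\mathcal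 A_{i,:,:}\|_F^2},\qquad \lambda_c=\max_j\frac{\|\mathcal A_{:,j,:}\|_2^2}{\|\mathcal A_{:,j,:}\|_F^2},$$ the maxima being over the nonzero slices. **Algorithm.** Let $S_\lambda$ be the entrywise map $x\mapsto\max\{|x|-\lambda,0\}\,\mathrm{sgn}(x)$. Start with $\mathcal Z^{(0)}=\mathcal B$, a deterministic $\mathcal Y^{(0)}\in\mathrm{ran}_K(\mathcal A^\top)$, and $\mathcal X^{(0)}=S_\lambda(\mathcal Y^{(0)})$. In step $k=1,2,\dots$ pick $j_k$ with probability $\|\mathcal A_{:,j_k,:}\|_F^2/\|\mathcal A\|_F^2$ and $i_k$ with probability $\|\mathcal A_{i_k,:,:}\|_F^2/\|\mathcal A\|_F^2$, all picks being independent, and set $$\mathcal Z^{(k)}=\mathcal Z^{(k-1)}-\alpha_c\,\mathcal A_{:,j_k,:}*\frac{(\mathcal A_{:,j_k,:})^\top*\mathcal Z^{(k-1)}}{\|\mathcal A_{:,j_k,:}\|_F^2},$$ $$\mathcal Y^{(k)}=\mathcal Y^{(k-1)}-\alpha_r(\mathcal A_{i_k,:,:})^\top*\frac{\mathcal A_{i_k,:,:}*\mathcal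 X^{(k-1)}-\mathcal B_{i_k,:,:}+\mathcal Z^{(k)}_{i_k,:,:}}{\|\mathcal A_{i_k,:,:}\|_F^2},\qquad \mathcal X^{(k)}=S_\lambda(\mathcal Y^{(k)}).$$ **Statement.** The problem of minimizing $f(\mathcal X)$ subject to $\mathcal A^\top*\mathcal A*\mathcal X=\mathcal A^\top*\mathcal B$ has a unique solution $\widehat{\mathcal X}$, and there is a constant $\nu>0$ such that $$D_{f,\mathcal Z}(\mathcal X,\widehat{\mathcal X})\le\frac1\nu\|\mathcal A*(\mathcal X-\widehat{\mathcal X})\|_F^2\quad\text{for all }\mathcal X\text{ and all }\mathcal Z\in\partial f(\mathcal X)\cap\mathrm{ran}_K(\mathcal A^\top).\tag{1}$$ Let $\nu>0$ be any constant satisfying (1), let $0<\alpha_c<2/\lambda_c$ and $0<\alpha_r<2/\lambda_r$, and put $$\rho_c=1-\frac{(2\alpha_c-\alpha_c^2\lambda_c)\,\sigma_{\min}^2(\mathrm{bcirc}(\mathcal A))}{\|\mathcal A\|_F^2},\qquad \rho_r=1-\frac{(2\alpha_r-\alpha_r^2\lambda_r)\,\nu}{2\|\mathcal A\|_F^2},\qquad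 \rho=\max\{\rho_c,\rho_r\}.$$ Then $\mathcal Y^{(k)}\in\partial f(\mathcal X^{(k)})$ for all $k\ge0$, the expectations below exist, and for all $\delta>0$ and all $k\ge0$ $$\mathbb E\big[D_{f,\mathcal Y^{(k)}}(\mathcal X^{(k)},\widehat{\mathcal X})\big]\le\frac{\delta+1}{2\delta}\,\frac{\alpha_r^2\lambda_r}{\|\mathcal A\|_F^2}\,\|\mathcal A*\mathcal A^\dagger*\mathcal B\|_F^2\sum_{l=0}^{k-1}\rho_c^{k-l}(1+\delta)^l\rho_r^l+(1+\delta)^k\rho_r^k\,D_{f,\mathcal Y^{(0)}}(\mathcal X^{(0)},\widehat{\mathcal X}).$$ Moreover $0\le\rho<1$, and with $$C_\delta=D_{f,\mathcal Y^{(0)}}(\mathcal X^{(0)},\widehat{\mathcal X})+\frac{\delta+1}{2\delta^2}\,\frac{\alpha_r^2\lambda_r}{\|\mathcal A\|_F^2}\,\|\mathcal A*\mathcal A^\dagger*\mathcal B\|_F^2$$ we have, for all $\delta>0$ and $k\ge0$, $$\mathbb E\big[D_{f,\mathcal Y^{(k)}}(\mathcal X^{(k)},\widehat{\mathcal X})\big]\le(1+\delta)^k\rho^k\,C_\delta,\qquad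 \mathbb E\big[\|\mathcal X^{(k)}-\widehat{\mathcal X}\|_F^2\big]\le 2(1+\delta)^k\rho^k\,C_\delta .$$ So, choosing $\delta$ with $(1+\delta)\rho<1$, the algorithm converges linearly in expectation to the unique solution. -/

import Mathlib

open MeasureTheory ProbabilityTheory

noncomputable section

namespace TensorRecovery

/-! ### Third-order tensors and the t-product -/

/-- Real third-order tensors of size `N₁ × N₂ × N₃`; all indices are zero-based.
The algebraic operations are entrywise. -/
abbrev Tensor (N₁ N₂ N₃ : ℕ) : Type := Fin N₁ → Fin N₂ → Fin N₃ → ℝ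

/-- The block circulant matrix: its block in block-row `p` and block-column `q` is the frontal
slice with index `p - q` modulo `N₃`. A row (or column) index is a pair (block, position). -/
def bcirc {N₁ N₂ N₃ : ℕ} (A : Tensor N₁ N₂ N₃) :
    Matrix (Fin N₃ × Fin N₁) (Fin N₃ × Fin N₂) ℝ :=
  Matrix.of fun p q => A p.2 q.2 (p.1 - q.1)

/-- The frontal slices stacked on top of each other. -/
def unfold {N₁ N₂ N₃ : ℕ} (A : Tensor N₁ N₂ N₃) : Matrix (Fin N₃ × Fin N₁) (Fin N₂) ℝ :=
  Matrix.of fun p j => A p.2 j p.1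

/-- The inverse of `unfold`. -/
def fold {N₁ N₂ N₃ : ℕ} (M : Matrix (Fin N₃ × Fin N₁) (Fin N₂) ℝ) : Tensor N₁ N₂ N₃ :=
  fun i j k => M (k, i) j

/-- The t-product `A * B`. -/
def tmul {N₁ N₂ K N₃ : ℕ} (A : Tensor N₁ N₂ N₃) (B : Tensor N₂ K N₃) : Tensor N₁ K N₃ :=
  fold (bcirc A * unfold B)

/-- The tensor transpose: every frontal slice is transposed, and the order of all frontal slices
but the first is reversed (index `k` goes to `-k` modulo `N₃`). -/
def ttrans {N₁ N₂ N₃ : ℕ} (A : Tensor N₁ N₂ N₃) : Tensor N₂ N₁ N₃ :=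
  fun j i k => A i j (-k)

/-- The `i`-th horizontal slice. -/
def hslice {N₁ N₂ N₃ : ℕ} (A : Tensor N₁ N₂ N₃) (i : Fin N₁) : Tensor 1 N₂ N₃ :=
  fun _ j k => A i j k

/-- The `j`-th lateral slice. -/
def lslice {N₁ N₂ N₃ : ℕ} (A : Tensor N₁ N₂ N₃) (j : Fin N₂) : Tensor N₁ 1 N₃ :=
  fun i _ k => A i j k

/-- The inner product of tensors. -/
def tinner {N₁ N₂ N₃ : ℕ} (A B : Tensor N₁ N₂ N₃) : ℝ :=
  ∑ i, ∑ j, ∑ k, A i j k * B i j k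

/-- The Frobenius norm. -/
def frobNorm {N₁ N₂ N₃ : ℕ} (A : Tensor N₁ N₂ N₃) : ℝ :=
  Real.sqrt (tinner A A)

/-- The entrywise 1-norm. -/
def oneNorm {N₁ N₂ N₃ : ℕ} (A : Tensor N₁ N₂ N₃) : ℝ :=
  ∑ i, ∑ j, ∑ k, |A i j k|

/-- The linear map between Euclidean spaces given by a real matrix. -/
def euclLin {m n : Type} [Fintype m] [Fintype n] [DecidableEq n] (M : Matrix m n ℝ) :
    EuclideanSpace ℝ n →ₗ[ℝ] EuclideanSpace ℝ m :=
  Matrix.toLpLin 2 2 M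

/-- The spectral norm of a tensor, that is, the Euclidean operator norm of `bcirc A`. -/
def specNorm {N₁ N₂ N₃ : ℕ} (A : Tensor N₁ N₂ N₃) : ℝ :=
  ‖(euclLin (bcirc A)).toContinuousLinearMap‖

/-- The minimum nonzero singular value of a matrix (of a nonzero matrix, in use). -/
def sigmaMin {m n : Type} [Fintype m] [Fintype n] [DecidableEq n] (M : Matrix m n ℝ) : ℝ :=
  sInf {s : ℝ | s ≠ 0 ∧ s ∈ Set.range (euclLin M).singularValues}

/-- `A.range_K`: the set of all `A * Y` with `Y` of size `N₂ × K × N₃`. -/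
def rangeK {N₁ N₂ N₃ : ℕ} (K : ℕ) (A : Tensor N₁ N₂ N₃) : Set (Tensor N₁ K N₃) :=
  Set.range fun Y : Tensor N₂ K N₃ => tmul A Y

/-! ### The Moore-Penrose pseudoinverse -/

/-- The four Penrose conditions: `P` is the Moore-Penrose pseudoinverse of `M`. -/
structure IsMoorePenrose {m n : Type} [Fintype m] [Fintype n]
    (M : Matrix m n ℝ) (P : Matrix n m ℝ) : Prop where
  mul_mul_self : M * P * M = M
  self_mul_mul : P * M * P = P
  symm_left : (M * P).transpose = M * P
  symm_right : (P * M).transpose = P * M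

theorem IsMoorePenrose.unique {m n : Type} [Fintype m] [Fintype n]
    {M : Matrix m n ℝ} {P Q : Matrix n m ℝ}
    (hP : IsMoorePenrose M P) (hQ : IsMoorePenrose M Q) : P = Q := by
  have h1 : M * P = M * Q := by
    calc M * P = (M * P).transpose := hP.symm_left.symm
      _ = ((M * Q) * (M * P)).transpose := by
          rw [← Matrix.mul_assoc, hQ.mul_mul_self]
      _ = (M * P) * (M * Q) := by
          rw [Matrix.transpose_mul, hP.symm_left, hQ.symm_left]
      _ = M * Q := by rw [← Matrix.mul_assoc, hP.mul_mul_self]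
  have h2 : P * M = Q * M := by
    calc P * M = (P * M).transpose := hP.symm_right.symm
      _ = ((P * M) * (Q * M)).transpose := by
          rw [Matrix.mul_assoc, ← Matrix.mul_assoc M, hQ.mul_mul_self]
      _ = (Q * M) * (P * M) := by
          rw [Matrix.transpose_mul, hP.symm_right, hQ.symm_right]
      _ = Q * M := by rw [Matrix.mul_assoc, ← Matrix.mul_assoc M, hP.mul_mul_self]
  calc P = P * (M * P) := by rw [← Matrix.mul_assoc, hP.self_mul_mul]
    _ = Q * (M * Q) := by rw [h1, ← Matrix.mul_assoc, h2, Matrix.mul_assoc]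
    _ = Q := by rw [← Matrix.mul_assoc, hQ.self_mul_mul]

theorem IsMoorePenrose.exists {m n : Type} [Fintype m] [Fintype n] [DecidableEq n]
    (M : Matrix m n ℝ) : ∃ P, IsMoorePenrose M P := by
  classical
  have hH : (M.transpose * M).IsHermitian := by
    simpa using Matrix.isHermitian_conjTranspose_mul_self M
  set H := M.transpose * M with hHdef
  -- a symmetric reflexive inverse of the Gram matrix that commutes with it
  obtain ⟨G, hG1, hG2, hG3, hG4⟩ :
      ∃ G : Matrix n n ℝ, H * G * H = H ∧ G * H * G = G ∧ G.transpose = G ∧ H * G = G * H := by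
    set U : Matrix n n ℝ := (hH.eigenvectorUnitary : Matrix n n ℝ) with hU
    set D : Matrix n n ℝ := Matrix.diagonal hH.eigenvalues with hD
    set E : Matrix n n ℝ := Matrix.diagonal (fun i => (hH.eigenvalues i)⁻¹) with hE
    have hUU : U.transpose * U = 1 := by
      have := Unitary.coe_star_mul_self hH.eigenvectorUnitary
      simpa [Matrix.star_eq_conjTranspose] using this
    have hsp : H = U * D * U.transpose := by
      have := hH.spectral_theorem
      simpa [Unitary.conjStarAlgAut_apply, Matrix.star_eq_conjTranspose, Function.comp_def]
        using this
    have key : ∀ X Y : Matrix n n ℝ,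
        (U * X * U.transpose) * (U * Y * U.transpose) = U * (X * Y) * U.transpose := by
      intro X Y
      calc (U * X * U.transpose) * (U * Y * U.transpose)
          = U * X * (U.transpose * U) * Y * U.transpose := by simp only [Matrix.mul_assoc]
        _ = _ := by rw [Matrix.mul_assoc U X, hUU]; simp only [Matrix.mul_assoc, Matrix.mul_one]
    refine ⟨U * E * U.transpose, ?_, ?_, ?_, ?_⟩
    · rw [hsp, key, key, hD, hE, Matrix.diagonal_mul_diagonal, Matrix.diagonal_mul_diagonal]
      congr 3
      ext i
      by_cases h : hH.eigenvalues i = 0 <;> simp [h]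
    · rw [hsp, key, key, hD, hE, Matrix.diagonal_mul_diagonal, Matrix.diagonal_mul_diagonal]
      congr 3
      ext i
      by_cases h : hH.eigenvalues i = 0 <;> simp [h]
    · rw [Matrix.transpose_mul, Matrix.transpose_mul, hE, Matrix.diagonal_transpose,
        Matrix.transpose_transpose, Matrix.mul_assoc]
    · rw [hsp, key, key, hD, hE, Matrix.diagonal_mul_diagonal, Matrix.diagonal_mul_diagonal]
      congr 3
      ext i
      exact mul_comm _ _
  have hHt : H.transpose = H := by rw [hHdef, Matrix.transpose_mul, Matrix.transpose_transpose]
  have hMGH : M * (G * H) = M := by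
    have h0 : (M * (G * H) - M).transpose * (M * (G * H) - M) = 0 := by
      have e : (M * (G * H) - M).transpose * (M * (G * H) - M)
          = (H * G - 1) * (H * (G * H) - H) := by
        rw [Matrix.transpose_sub, Matrix.transpose_mul, Matrix.transpose_mul, hG3, hHt,
          hHdef, Matrix.mul_sub, Matrix.sub_mul, Matrix.sub_mul, Matrix.sub_mul, Matrix.mul_sub,
          Matrix.mul_sub, Matrix.one_mul, Matrix.one_mul]
        simp only [Matrix.mul_assoc]
      rw [e, ← Matrix.mul_assoc H, hG1, sub_self, Matrix.mul_zero]
    have h1 : M * (G * H) - M = 0 := by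
      rw [← Matrix.conjTranspose_eq_transpose_of_trivial] at h0
      exact Matrix.conjTranspose_mul_self_eq_zero.1 h0
    exact sub_eq_zero.1 h1
  refine ⟨G * M.transpose, ?_, ?_, ?_, ?_⟩
  · rw [Matrix.mul_assoc, Matrix.mul_assoc, ← hHdef, hMGH]
  · rw [Matrix.mul_assoc G, ← hHdef, ← Matrix.mul_assoc, hG2]
  · rw [Matrix.transpose_mul, Matrix.transpose_mul, hG3, Matrix.transpose_transpose,
      Matrix.mul_assoc]
  · rw [Matrix.mul_assoc, ← hHdef, Matrix.transpose_mul, hG3, hHt, hG4]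

/-- Every tensor has exactly one pseudoinverse. -/
theorem existsUnique_pinv {N₁ N₂ N₃ : ℕ} (A : Tensor N₁ N₂ N₃) :
    ∃! P : Tensor N₂ N₁ N₃, IsMoorePenrose (bcirc A) (bcirc P) := by
  cases N₃ with
  | zero =>
    refine ⟨fun _ _ k => k.elim0, ⟨?_, ?_, ?_, ?_⟩, fun Q _ => ?_⟩
    · ext p; exact p.1.elim0
    · ext p; exact p.1.elim0
    · ext p; exact p.1.elim0
    · ext p; exact p.1.elim0
    · funext i j k; exact k.elim0
  | succ n =>
    obtain ⟨P, hP⟩ := IsMoorePenrose.exists (bcirc A)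
    have hshift : ∀ s : Fin (n + 1), ∀ p q, P (p.1 + s, p.2) (q.1 + s, q.2) = P p q := by
      intro s
      let e (N : ℕ) : Fin (n + 1) × Fin N ≃ Fin (n + 1) × Fin N :=
        (Equiv.addRight s).prodCongr (Equiv.refl _)
      have hM : (bcirc A).submatrix (e N₁) (e N₂) = bcirc A := by
        ext p q
        simp [bcirc, e]
      have hQ : IsMoorePenrose (bcirc A) (P.submatrix (e N₂) (e N₁)) := by
        refine ⟨?_, ?_, ?_, ?_⟩
        · have := congrArg (fun X => X.submatrix (e N₁) (e N₂)) hP.mul_mul_self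
          simpa only [← Matrix.submatrix_mul_equiv _ _ _ (e N₁),
            ← Matrix.submatrix_mul_equiv _ _ _ (e N₂), hM] using this
        · have := congrArg (fun X => X.submatrix (e N₂) (e N₁)) hP.self_mul_mul
          simpa only [← Matrix.submatrix_mul_equiv _ _ _ (e N₁),
            ← Matrix.submatrix_mul_equiv _ _ _ (e N₂), hM] using this
        · have := congrArg (fun X => X.submatrix (e N₁) (e N₁)) hP.symm_left
          simpa only [← Matrix.transpose_submatrix,
            ← Matrix.submatrix_mul_equiv _ _ _ (e N₂), hM] using this
        · have := congrArg (fun X => X.submatrix (e N₂) (e N₂)) hP.symm_right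
          simpa only [← Matrix.transpose_submatrix,
            ← Matrix.submatrix_mul_equiv _ _ _ (e N₁), hM] using this
      intro p q
      have := congrFun (congrFun (hQ.unique hP) p) q
      simpa [e, Prod.map] using this
    have hc : bcirc (fun j i k => P (k, j) (0, i)) = P := by
      ext p q
      have := hshift q.1 (p.1 - q.1, p.2) (0, q.2)
      simpa [bcirc] using this.symm
    refine ⟨fun j i k => P (k, j) (0, i), ?_, fun Q hQ => ?_⟩
    · simpa only [hc] using hP
    · have hQP : bcirc Q = P := hQ.unique hP
      funext j i k
      simp [← hQP, bcirc]

/-- The tensor pseudoinverse: the tensor `P` with `bcirc P` the Moore-Penrose pseudoinverse of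
`bcirc A`. -/
def tpinv {N₁ N₂ N₃ : ℕ} (A : Tensor N₁ N₂ N₃) : Tensor N₂ N₁ N₃ :=
  (existsUnique_pinv A).choose

theorem tpinv_spec {N₁ N₂ N₃ : ℕ} (A : Tensor N₁ N₂ N₃) :
    IsMoorePenrose (bcirc A) (bcirc (tpinv A)) :=
  (existsUnique_pinv A).choose_spec.1

/-! ### Convex analysis and the sparse recovery problem -/

/-- The subdifferential of `f` at `X`. -/
def subdiff {N₁ N₂ N₃ : ℕ} (f : Tensor N₁ N₂ N₃ → ℝ) (X : Tensor N₁ N₂ N₃) :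
    Set (Tensor N₁ N₂ N₃) :=
  {Z | ∀ Y, f X + tinner Z (Y - X) ≤ f Y}

/-- The Bregman distance `D_{f,Z}(X, Y)`, meaningful when `Z ∈ subdiff f X`. -/
def bregman {N₁ N₂ N₃ : ℕ} (f : Tensor N₁ N₂ N₃ → ℝ) (Z X Y : Tensor N₁ N₂ N₃) : ℝ :=
  f Y - f X - tinner Z (Y - X)

/-- The objective `‖X‖_F² / 2 + lam ‖X‖₁`. -/
def sparseObj {N₁ N₂ N₃ : ℕ} (lam : ℝ) (X : Tensor N₁ N₂ N₃) : ℝ :=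
  1 / 2 * frobNorm X ^ 2 + lam * oneNorm X

/-- `X` is feasible: `Aᵀ * A * X = Aᵀ * B`. -/
def IsFeasible {N₁ N₂ K N₃ : ℕ} (A : Tensor N₁ N₂ N₃) (B : Tensor N₁ K N₃)
    (X : Tensor N₂ K N₃) : Prop :=
  tmul (tmul (ttrans A) A) X = tmul (ttrans A) B

/-- `X` minimizes the objective over the feasible tensors. -/
def IsSparseSolution {N₁ N₂ K N₃ : ℕ} (A : Tensor N₁ N₂ N₃) (B : Tensor N₁ K N₃) (lam : ℝ)
    (X : Tensor N₂ K N₃) : Prop :=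
  IsFeasible A B X ∧ ∀ X', IsFeasible A B X' → sparseObj lam X ≤ sparseObj lam X'

/-- The error bound with constant `ν`: `D_{f,Z}(X, Xh) ≤ ‖A * (X - Xh)‖_F² / ν` for all `X` and
all `Z` in the subdifferential of `f` at `X` that lie in the `K`-range of `Aᵀ`. -/
def ErrorBound {N₁ N₂ K N₃ : ℕ} (A : Tensor N₁ N₂ N₃) (f : Tensor N₂ K N₃ → ℝ)
    (Xh : Tensor N₂ K N₃) (ν : ℝ) : Prop :=
  ∀ X, ∀ Z ∈ subdiff f X ∩ rangeK K (ttrans A),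
    bregman f Z X Xh ≤ 1 / ν * frobNorm (tmul A (X - Xh)) ^ 2

/-- The soft shrinkage function, applied entrywise. -/
def softShrink {N₁ N₂ N₃ : ℕ} (lam : ℝ) (X : Tensor N₁ N₂ N₃) : Tensor N₁ N₂ N₃ :=
  fun i j k => max (|X i j k| - lam) 0 * Real.sign (X i j k)

/-! ### The algorithm -/

/-- The iterates kept by the algorithm. -/
structure State (N₁ N₂ K N₃ : ℕ) where
  Z : Tensor N₁ K N₃
  Y : Tensor N₂ K N₃
  X : Tensor N₂ K N₃

/-- One step of the algorithm, with lateral slice `j` and horizontal slice `i`; the update of `Y`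
uses the new `Z`. -/
def step {N₁ N₂ K N₃ : ℕ} (A : Tensor N₁ N₂ N₃) (B : Tensor N₁ K N₃) (lam αc αr : ℝ)
    (j : Fin N₂) (i : Fin N₁) (s : State N₁ N₂ K N₃) : State N₁ N₂ K N₃ :=
  let Z' := s.Z - αc • tmul (lslice A j)
    ((1 / frobNorm (lslice A j) ^ 2) • tmul (ttrans (lslice A j)) s.Z)
  let Y' := s.Y - αr • tmul (ttrans (hslice A i))
    ((1 / frobNorm (hslice A i) ^ 2) • (tmul (hslice A i) s.X - hslice B i + hslice Z' i))
  ⟨Z', Y', softShrink lam Y'⟩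

/-- The state after `k` steps; `j k` and `i k` are the slices picked in step `k + 1`. -/
def iterate {N₁ N₂ K N₃ : ℕ} (A : Tensor N₁ N₂ N₃) (B : Tensor N₁ K N₃) (lam αc αr : ℝ)
    (Y₀ : Tensor N₂ K N₃) (j : ℕ → Fin N₂) (i : ℕ → Fin N₁) : ℕ → State N₁ N₂ K N₃
  | 0 => ⟨B, Y₀, softShrink lam Y₀⟩
  | k + 1 => step A B lam αc αr (j k) (i k) (iterate A B lam αc αr Y₀ j i k)

/-- The random picks: all of `j 0, i 0, j 1, i 1, …` are independent, `j k` takes the value `a`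
with probability `‖A_{:,a,:}‖_F² / ‖A‖_F²`, and `i k` takes the value `a` with probability
`‖A_{a,:,:}‖_F² / ‖A‖_F²`. -/
structure IsPicks {N₁ N₂ N₃ : ℕ} (A : Tensor N₁ N₂ N₃) {Ω : Type*} [MeasurableSpace Ω]
    (μ : Measure Ω) (j : ℕ → Ω → Fin N₂) (i : ℕ → Ω → Fin N₁) : Prop where
  measurable_j : ∀ k, Measurable (j k)
  measurable_i : ∀ k, Measurable (i k)
  indep_steps : iIndepFun (fun k ω => (j k ω, i k ω)) μ
  indep_within : ∀ k, IndepFun (j k) (i k) μ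
  prob_j : ∀ k a, μ.real {ω | j k ω = a} = frobNorm (lslice A a) ^ 2 / frobNorm A ^ 2
  prob_i : ∀ k a, μ.real {ω | i k ω = a} = frobNorm (hslice A a) ^ 2 / frobNorm A ^ 2

/-- The `k`-th state as a random variable. -/
def run {N₁ N₂ K N₃ : ℕ} (A : Tensor N₁ N₂ N₃) (B : Tensor N₁ K N₃) (lam αc αr : ℝ)
    (Y₀ : Tensor N₂ K N₃) {Ω : Type*} (j : ℕ → Ω → Fin N₂) (i : ℕ → Ω → Fin N₁) (k : ℕ) (ω : Ω) :
    State N₁ N₂ K N₃ :=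
  iterate A B lam αc αr Y₀ (fun t => j t ω) (fun t => i t ω) k

/-- The Bregman distance of the `k`-th iterate to `Xh` as a random variable. -/
def bregErr {N₁ N₂ K N₃ : ℕ} (A : Tensor N₁ N₂ N₃) (B : Tensor N₁ K N₃) (lam αc αr : ℝ)
    (Y₀ Xh : Tensor N₂ K N₃) {Ω : Type*} (j : ℕ → Ω → Fin N₂) (i : ℕ → Ω → Fin N₁) (k : ℕ)
    (ω : Ω) : ℝ :=
  bregman (sparseObj lam) (run A B lam αc αr Y₀ j i k ω).Y (run A B lam αc αr Y₀ j i k ω).X Xh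

/-! ### The constants of the convergence estimate -/

/-- The maximum over the horizontal slices of `‖A_{i,:,:}‖₂² / ‖A_{i,:,:}‖_F²`; a zero slice
contributes `0 / 0 = 0`, so it does not count. -/
def lamR {N₁ N₂ N₃ : ℕ} (A : Tensor N₁ N₂ N₃) : ℝ :=
  ⨆ i, specNorm (hslice A i) ^ 2 / frobNorm (hslice A i) ^ 2

/-- The maximum over the lateral slices of `‖A_{:,j,:}‖₂² / ‖A_{:,j,:}‖_F²`; a zero slice
contributes `0 / 0 = 0`, so it does not count. -/
def lamC {N₁ N₂ N₃ : ℕ} (A : Tensor N₁ N₂ N₃) : ℝ :=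
  ⨆ j, specNorm (lslice A j) ^ 2 / frobNorm (lslice A j) ^ 2

def rhoC {N₁ N₂ N₃ : ℕ} (A : Tensor N₁ N₂ N₃) (αc : ℝ) : ℝ :=
  1 - (2 * αc - αc ^ 2 * lamC A) * sigmaMin (bcirc A) ^ 2 / frobNorm A ^ 2

def rhoR {N₁ N₂ N₃ : ℕ} (A : Tensor N₁ N₂ N₃) (αr ν : ℝ) : ℝ :=
  1 - (2 * αr - αr ^ 2 * lamR A) * ν / (2 * frobNorm A ^ 2)

/-- The constant `αr² lamR / ‖A‖_F² * ‖A * A† * B‖_F²`. -/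
def resConst {N₁ N₂ K N₃ : ℕ} (A : Tensor N₁ N₂ N₃) (B : Tensor N₁ K N₃) (αr : ℝ) : ℝ :=
  αr ^ 2 * lamR A / frobNorm A ^ 2 * frobNorm (tmul (tmul A (tpinv A)) B) ^ 2

end TensorRecovery

end

open TensorRecovery

/-!
With `f = ‖·‖_F² / 2 + lam ‖·‖₁`, the map `softShrink lam` inverts the subdifferential of `f`, and
`f` is strongly convex with modulus 1. Both facts are read off entrywise
(`IsEntrywiseSubgrad.sparseObj_le`, `isEntrywiseSubgrad_softShrink`).

*Solution.* A minimizer exists by compactness of sublevel sets. Hahn-Banach, applied to the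
directional derivative of `f`, yields a subgradient in the range of `Aᵀ` at the minimizer
(`IsSparseSolution.exists_mem_subdiff`); uniqueness follows by strong convexity.

*Error bound.* For `Z ∈ ∂f(X)` and `P ∈ ∂f(Xh)`, both in the range of `Aᵀ`, the Bregman distance is
at most `⟨Z - P, X - Xh⟩ = ⟨Z - P, A† * A * (X - Xh)⟩`, because `A† * A` is the orthogonal projection
onto this range. The set `∂f(Xh)` is a box, so a Hoffman bound for the intersection of a subspace
with a box (`exists_dist_subspace_inter_box_le`) allows `P` to be chosen with `‖Z - P‖_F` of the order
of `‖X - Xh‖_F`, which strong convexity bounds by the square root of the Bregman distance. Dividing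
by this square root gives the bound (`exists_errorBound`). The Hoffman bound itself comes from
compactness, one constant for each of the finitely many patterns of active constraints.

*Convergence.* The deviation `E = Z - (B - A * Xh)` stays in the range of `A`, where the adjoint of `A`
expands by at least the least nonzero singular value (`sigmaMin_sq_mul_norm_sq_le`); hence `‖E‖_F²`
contracts by `rhoC` on average (`sum_tinner_zErr_step_le`). The step for `Y` is compared with the step
for consistent data, which contracts the Bregman distance by `rhoR` on average thanks to the error
bound; Young's inequality accounts for `E` (`bregman_step_le`, `sum_bregman_step_le`). As each pick
is independent of the past, averaging over it gives a linear recursion for the expectations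
(`integral_step_eq`), solved in `le_of_linear_recursion`. The recursion needs `0 ≤ rhoR`, which holds
unless `softShrink lam` maps the whole range of `Aᵀ` to the solution; then everything vanishes.
-/

noncomputable section

namespace TensorRecovery

/-! ### Algebra of the t-product and of the inner product -/

section Algebra

variable {N₁ N₂ N₃ K L : ℕ}

theorem tinner_comm (X Y : Tensor N₁ N₂ N₃) : tinner X Y = tinner Y X := by
  simp only [tinner, mul_comm]

theorem tinner_add_left (X Y Z : Tensor N₁ N₂ N₃) :
    tinner (X + Y) Z = tinner X Z + tinner Y Z := by
  simp only [tinner, Pi.add_apply, add_mul, Finset.sum_add_distrib]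

theorem tinner_smul_left (c : ℝ) (X Y : Tensor N₁ N₂ N₃) :
    tinner (c • X) Y = c * tinner X Y := by
  simp only [tinner, Pi.smul_apply, smul_eq_mul, mul_assoc, Finset.mul_sum]

theorem tinner_add_right (X Y Z : Tensor N₁ N₂ N₃) :
    tinner X (Y + Z) = tinner X Y + tinner X Z := by
  simp only [tinner_comm X, tinner_add_left]

theorem tinner_smul_right (c : ℝ) (X Y : Tensor N₁ N₂ N₃) :
    tinner X (c • Y) = c * tinner X Y := by
  simp only [tinner_comm X, tinner_smul_left]

theorem tinner_neg_left (X Y : Tensor N₁ N₂ N₃) : tinner (-X) Y = -tinner X Y := by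
  rw [← neg_one_smul ℝ X, tinner_smul_left]; ring

theorem tinner_neg_right (X Y : Tensor N₁ N₂ N₃) : tinner X (-Y) = -tinner X Y := by
  rw [tinner_comm, tinner_neg_left, tinner_comm]

theorem tinner_sub_left (X Y Z : Tensor N₁ N₂ N₃) :
    tinner (X - Y) Z = tinner X Z - tinner Y Z := by
  rw [sub_eq_add_neg, tinner_add_left, tinner_neg_left, sub_eq_add_neg]

theorem tinner_sub_right (X Y Z : Tensor N₁ N₂ N₃) :
    tinner X (Y - Z) = tinner X Y - tinner X Z := by
  simp only [tinner_comm X, tinner_sub_left]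

@[simp]
theorem tinner_zero_left (X : Tensor N₁ N₂ N₃) : tinner 0 X = 0 := by simp [tinner]

@[simp]
theorem tinner_zero_right (X : Tensor N₁ N₂ N₃) : tinner X 0 = 0 := by simp [tinner]

theorem tinner_self_nonneg (X : Tensor N₁ N₂ N₃) : 0 ≤ tinner X X :=
  Finset.sum_nonneg fun _ _ => Finset.sum_nonneg fun _ _ => Finset.sum_nonneg fun _ _ =>
    mul_self_nonneg _

theorem sq_entry_le_tinner_self (X : Tensor N₁ N₂ N₃) (i j k) : X i j k ^ 2 ≤ tinner X X := by
  have h0 : ∀ i j k, 0 ≤ X i j k * X i j k := fun i j k => mul_self_nonneg _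
  calc X i j k ^ 2 = X i j k * X i j k := sq _
    _ ≤ ∑ k, X i j k * X i j k :=
        Finset.single_le_sum (f := fun k => X i j k * X i j k) (fun k _ => h0 i j k)
          (Finset.mem_univ k)
    _ ≤ ∑ j, ∑ k, X i j k * X i j k :=
        Finset.single_le_sum (f := fun j => ∑ k, X i j k * X i j k)
          (fun j _ => Finset.sum_nonneg fun k _ => h0 i j k) (Finset.mem_univ j)
    _ ≤ tinner X X :=
        Finset.single_le_sum (f := fun i => ∑ j, ∑ k, X i j k * X i j k)
          (fun i _ => Finset.sum_nonneg fun j _ => Finset.sum_nonneg fun k _ => h0 i j k)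
          (Finset.mem_univ i)

theorem eq_zero_of_tinner_self {X : Tensor N₁ N₂ N₃} (h : tinner X X = 0) : X = 0 := by
  funext i j k
  have := sq_entry_le_tinner_self X i j k
  rw [h] at this
  exact pow_eq_zero_iff two_ne_zero |>.1 (le_antisymm this (sq_nonneg _))

theorem tinner_self_pos {X : Tensor N₁ N₂ N₃} (h : X ≠ 0) : 0 < tinner X X :=
  lt_of_le_of_ne (tinner_self_nonneg X) fun h0 => h (eq_zero_of_tinner_self h0.symm)

theorem frobNorm_sq (X : Tensor N₁ N₂ N₃) : frobNorm X ^ 2 = tinner X X :=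
  Real.sq_sqrt (tinner_self_nonneg X)

theorem tinner_sq_le (X Y : Tensor N₁ N₂ N₃) : tinner X Y ^ 2 ≤ tinner X X * tinner Y Y := by
  have h : ∀ t : ℝ, 0 ≤ tinner Y Y * (t * t) + 2 * tinner X Y * t + tinner X X := fun t => by
    have := tinner_self_nonneg (X + t • Y)
    simp only [tinner_add_left, tinner_add_right, tinner_smul_left, tinner_smul_right,
      tinner_comm Y X] at this
    linarith
  have := discrim_le_zero h
  rw [discrim] at this
  linarith

/-- Young's inequality. -/
theorem tinner_le_young {δ : ℝ} (hδ : 0 < δ) (X Y : Tensor N₁ N₂ N₃) :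
    tinner X Y ≤ 1 / (2 * δ) * tinner X X + δ / 2 * tinner Y Y := by
  have := tinner_self_nonneg (X - δ • Y)
  simp only [tinner_sub_left, tinner_sub_right, tinner_smul_left, tinner_smul_right,
    tinner_comm Y X] at this
  have h2 : 0 ≤ 1 / (2 * δ) * (tinner X X - δ * tinner X Y - δ * (tinner X Y - δ * tinner Y Y)) :=
    mul_nonneg (by positivity) (by linarith)
  have e : 1 / (2 * δ) * (tinner X X - δ * tinner X Y - δ * (tinner X Y - δ * tinner Y Y))
      = 1 / (2 * δ) * tinner X X + δ / 2 * tinner Y Y - tinner X Y := by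
    field_simp; ring
  linarith

theorem tmul_add (A : Tensor N₁ N₂ N₃) (X Y : Tensor N₂ K N₃) :
    tmul A (X + Y) = tmul A X + tmul A Y := by
  have : unfold (X + Y) = unfold X + unfold Y := rfl
  simp only [tmul, this, Matrix.mul_add]; rfl

theorem tmul_smul (A : Tensor N₁ N₂ N₃) (c : ℝ) (X : Tensor N₂ K N₃) :
    tmul A (c • X) = c • tmul A X := by
  have : unfold (c • X) = c • unfold X := rfl
  simp only [tmul, this, Matrix.mul_smul]; rfl

@[simp]
theorem tmul_zero (A : Tensor N₁ N₂ N₃) : tmul A (0 : Tensor N₂ K N₃) = 0 := by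
  simpa using tmul_smul A 0 (0 : Tensor N₂ K N₃)

theorem tmul_sub (A : Tensor N₁ N₂ N₃) (X Y : Tensor N₂ K N₃) :
    tmul A (X - Y) = tmul A X - tmul A Y := by
  rw [sub_eq_add_neg, ← neg_one_smul ℝ Y, tmul_add, tmul_smul, neg_one_smul, ← sub_eq_add_neg]

theorem tmul_apply (A : Tensor N₁ N₂ N₃) (X : Tensor N₂ K N₃) (i j k) :
    tmul A X i j k = ∑ q, ∑ l, A i l (k - q) * X l j q := by
  simp [tmul, fold, bcirc, unfold, Matrix.mul_apply, Fintype.sum_prod_type]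

theorem hslice_tmul (A : Tensor N₁ N₂ N₃) (X : Tensor N₂ K N₃) (i : Fin N₁) :
    hslice (tmul A X) i = tmul (hslice A i) X := by
  funext _ j k
  simp [hslice, tmul_apply]

theorem ttrans_lslice (A : Tensor N₁ N₂ N₃) (j : Fin N₂) :
    ttrans (lslice A j) = hslice (ttrans A) j := rfl

theorem sum_tinner_hslice (X Y : Tensor N₁ N₂ N₃) :
    ∑ i, tinner (hslice X i) (hslice Y i) = tinner X Y := by
  simp [tinner, hslice]

theorem sum_tinner_lslice (X Y : Tensor N₁ N₂ N₃) :
    ∑ j, tinner (lslice X j) (lslice Y j) = tinner X Y := by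
  simp only [tinner, lslice, Finset.univ_unique, Finset.sum_singleton]
  exact Finset.sum_comm

theorem tinner_eq_trace (X Y : Tensor N₁ N₂ N₃) :
    tinner X Y = ((unfold X).transpose * unfold Y).trace := by
  simp only [tinner, Matrix.trace, Matrix.diag, Matrix.mul_apply, Matrix.transpose_apply, unfold,
    Matrix.of_apply, Fintype.sum_prod_type]
  rw [Finset.sum_comm]
  exact Finset.sum_congr rfl fun _ _ => Finset.sum_comm

theorem ttrans_ttrans (A : Tensor N₁ N₂ N₃) : ttrans (ttrans A) = A := by
  funext i j k
  simp [ttrans]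

section Cyclic

variable [NeZero N₃]

theorem bcirc_ttrans (A : Tensor N₁ N₂ N₃) : bcirc (ttrans A) = (bcirc A).transpose := by
  ext p q
  simp [bcirc, ttrans, neg_sub]

theorem bcirc_tmul (A : Tensor N₁ N₂ N₃) (X : Tensor N₂ K N₃) :
    bcirc (tmul A X) = bcirc A * bcirc X := by
  ext p q
  simp only [bcirc, Matrix.of_apply, tmul_apply, Matrix.mul_apply, Fintype.sum_prod_type]
  refine Fintype.sum_equiv (Equiv.addRight q.1) _ _ fun r => ?_
  simp [sub_sub, add_comm]

theorem bcirc_injective : Function.Injective (bcirc : Tensor N₁ N₂ N₃ → _) := by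
  intro X Y h
  funext i j k
  simpa [bcirc] using congrFun (congrFun h (k, i)) (0, j)

theorem tmul_assoc (A : Tensor N₁ N₂ N₃) (X : Tensor N₂ K N₃) (Y : Tensor K L N₃) :
    tmul (tmul A X) Y = tmul A (tmul X Y) := by
  apply bcirc_injective
  simp only [bcirc_tmul, Matrix.mul_assoc]

theorem ttrans_tmul (A : Tensor N₁ N₂ N₃) (X : Tensor N₂ K N₃) :
    ttrans (tmul A X) = tmul (ttrans X) (ttrans A) := by
  apply bcirc_injective
  simp only [bcirc_ttrans, bcirc_tmul, Matrix.transpose_mul]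

/-- `ttrans A` is the adjoint of `A` for the t-product. -/
theorem tinner_tmul_left (A : Tensor N₁ N₂ N₃) (X : Tensor N₂ K N₃) (Y : Tensor N₁ K N₃) :
    tinner (tmul A X) Y = tinner X (tmul (ttrans A) Y) := by
  have h : ∀ {N M : ℕ} (C : Tensor N M N₃) (Z : Tensor M K N₃),
      unfold (tmul C Z) = bcirc C * unfold Z := fun _ _ => rfl
  rw [tinner_eq_trace, tinner_eq_trace, h, h, bcirc_ttrans, Matrix.transpose_mul, Matrix.mul_assoc]

theorem tinner_tmul_right (A : Tensor N₁ N₂ N₃) (X : Tensor N₂ K N₃) (Y : Tensor N₁ K N₃) :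
    tinner Y (tmul A X) = tinner (tmul (ttrans A) Y) X := by
  rw [tinner_comm, tinner_tmul_left, tinner_comm]

theorem tinner_tmul_ttrans_left (A : Tensor N₁ N₂ N₃) (X : Tensor N₁ K N₃) (Y : Tensor N₂ K N₃) :
    tinner (tmul (ttrans A) X) Y = tinner X (tmul A Y) := by
  rw [tinner_tmul_left, ttrans_ttrans]

/-- `Aᵀ * A * X = 0` already forces `A * X = 0`. -/
theorem tmul_eq_zero_of_ttrans_tmul {A : Tensor N₁ N₂ N₃} {X : Tensor N₂ K N₃}
    (h : tmul (ttrans A) (tmul A X) = 0) : tmul A X = 0 := by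
  apply eq_zero_of_tinner_self
  rw [tinner_tmul_left, h, tinner_zero_right]

theorem exists_tmul_ne_zero {A : Tensor N₁ N₂ N₃} (hA : A ≠ 0) :
    ∃ X : Tensor N₂ 1 N₃, tmul A X ≠ 0 := by
  contrapose! hA
  funext i l k
  have := congrFun (congrFun (congrFun
    (hA fun l' _ q => if l' = l then if q = 0 then 1 else 0 else 0) i) 0) k
  simpa [tmul_apply] using this

end Cyclic

/-! ### The pseudoinverse -/

section Pinv

variable [NeZero N₃]

theorem tmul_tpinv_tmul_self (A : Tensor N₁ N₂ N₃) : tmul (tmul A (tpinv A)) A = A :=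
  bcirc_injective (by simpa only [bcirc_tmul] using (tpinv_spec A).mul_mul_self)

theorem ttrans_tmul_tpinv (A : Tensor N₁ N₂ N₃) :
    ttrans (tmul A (tpinv A)) = tmul A (tpinv A) :=
  bcirc_injective (by simpa only [bcirc_tmul, bcirc_ttrans] using (tpinv_spec A).symm_left)

theorem ttrans_tpinv_tmul (A : Tensor N₁ N₂ N₃) :
    ttrans (tmul (tpinv A) A) = tmul (tpinv A) A :=
  bcirc_injective (by simpa only [bcirc_tmul, bcirc_ttrans] using (tpinv_spec A).symm_right)

theorem ttrans_tmul_tmul_tpinv (A : Tensor N₁ N₂ N₃) :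
    tmul (ttrans A) (tmul A (tpinv A)) = ttrans A := by
  conv_rhs => rw [← tmul_tpinv_tmul_self A, ttrans_tmul, ttrans_tmul_tpinv]

theorem tpinv_tmul_ttrans (A : Tensor N₁ N₂ N₃) :
    tmul (tmul (tpinv A) A) (ttrans A) = ttrans A := by
  conv_rhs => rw [← tmul_tpinv_tmul_self A, tmul_assoc, ttrans_tmul, ttrans_tpinv_tmul]

/-- `A† * A` fixes the range of `Aᵀ`. -/
theorem tpinv_tmul_of_mem_rangeK {A : Tensor N₁ N₂ N₃} {Z : Tensor N₂ K N₃}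
    (hZ : Z ∈ rangeK K (ttrans A)) : tmul (tpinv A) (tmul A Z) = Z := by
  obtain ⟨W, rfl⟩ := hZ
  dsimp only
  rw [← tmul_assoc, ← tmul_assoc, tpinv_tmul_ttrans]

theorem tpinv_tmul_mem_rangeK (A : Tensor N₁ N₂ N₃) (Z : Tensor N₂ K N₃) :
    tmul (tpinv A) (tmul A Z) ∈ rangeK K (ttrans A) :=
  ⟨tmul (ttrans (tpinv A)) Z, by
    dsimp only
    rw [← tmul_assoc, ← tmul_assoc, ← ttrans_tmul, ttrans_tpinv_tmul]⟩

/-- A tensor orthogonal to the kernel of `A` lies in the range of `Aᵀ`. -/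
theorem mem_rangeK_ttrans {A : Tensor N₁ N₂ N₃} {Z : Tensor N₂ K N₃}
    (h : ∀ X, tmul A X = 0 → tinner Z X = 0) : Z ∈ rangeK K (ttrans A) := by
  set P := tmul (tpinv A) (tmul A Z) with hP
  have hk : tmul A (Z - P) = 0 := by
    rw [tmul_sub, hP, ← tmul_assoc, ← tmul_assoc, tmul_tpinv_tmul_self, sub_self]
  have hPmem := tpinv_tmul_mem_rangeK A Z
  rw [← hP] at hPmem
  have h2 : tinner P (Z - P) = 0 := by
    obtain ⟨W, hW⟩ := hPmem
    dsimp only at hW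
    rw [← hW, tinner_tmul_ttrans_left, hW, hk, tinner_zero_right]
  have : Z - P = 0 := eq_zero_of_tinner_self (by rw [tinner_sub_left, h _ hk, h2, sub_zero])
  rwa [sub_eq_zero.1 this]

end Pinv

/-! ### The spectral norm and the least nonzero singular value -/

/-- The `j`-th column of `unfold X` as a Euclidean vector. -/
def col (X : Tensor N₁ N₂ N₃) (j : Fin N₂) : EuclideanSpace ℝ (Fin N₃ × Fin N₁) :=
  WithLp.toLp 2 fun p => X p.2 j p.1

theorem tinner_self_eq_sum_col (X : Tensor N₁ N₂ N₃) : tinner X X = ∑ j, ‖col X j‖ ^ 2 := by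
  simp only [tinner, col, EuclideanSpace.real_norm_sq_eq, Fintype.sum_prod_type]
  simp only [sq]
  rw [Finset.sum_comm]
  exact Finset.sum_congr rfl fun _ _ => Finset.sum_comm

theorem col_tmul (A : Tensor N₁ N₂ N₃) (X : Tensor N₂ K N₃) (j : Fin K) :
    col (tmul A X) j = euclLin (bcirc A) (col X j) := by
  ext p
  simp [col, euclLin, tmul, fold, Matrix.mul_apply, Matrix.mulVec, dotProduct, unfold]

theorem tinner_tmul_self_le (A : Tensor N₁ N₂ N₃) (X : Tensor N₂ K N₃) :
    tinner (tmul A X) (tmul A X) ≤ specNorm A ^ 2 * tinner X X := by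
  rw [tinner_self_eq_sum_col, tinner_self_eq_sum_col, Finset.mul_sum]
  refine Finset.sum_le_sum fun j _ => ?_
  rw [col_tmul, ← mul_pow]
  exact pow_le_pow_left₀ (norm_nonneg _)
    ((euclLin (bcirc A)).toContinuousLinearMap.le_opNorm (col X j)) 2

theorem tinner_tmul_ttrans_self_le [NeZero N₃] (A : Tensor N₁ N₂ N₃) (X : Tensor N₁ K N₃) :
    tinner (tmul (ttrans A) X) (tmul (ttrans A) X) ≤ specNorm A ^ 2 * tinner X X := by
  set T := tinner (tmul (ttrans A) X) (tmul (ttrans A) X) with hT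
  have hT0 : 0 ≤ T := tinner_self_nonneg _
  have h1 : T ^ 2 ≤ tinner X X * (specNorm A ^ 2 * T) :=
    calc T ^ 2 = tinner X (tmul A (tmul (ttrans A) X)) ^ 2 := by
          rw [hT, tinner_tmul_ttrans_left]
      _ ≤ _ := tinner_sq_le _ _
      _ ≤ _ := mul_le_mul_of_nonneg_left (tinner_tmul_self_le _ _) (tinner_self_nonneg X)
  rcases hT0.eq_or_lt with h | h
  · rw [← h]
    exact mul_nonneg (sq_nonneg _) (tinner_self_nonneg X)
  · refine le_of_mul_le_mul_right ?_ h
    linarith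

/-- On its range, the adjoint of `T` expands by at least the least nonzero singular value. In an
eigenbasis of `T† T` this is `σ⁴ ≥ σ_min² σ²`, one eigenvalue at a time. -/
theorem sigmaMin_sq_mul_norm_sq_le {m n : Type} [Fintype m] [Fintype n] [DecidableEq m]
    [DecidableEq n] (M : Matrix m n ℝ) (v : EuclideanSpace ℝ n) :
    sigmaMin M ^ 2 * ‖euclLin M v‖ ^ 2 ≤ ‖euclLin M.transpose (euclLin M v)‖ ^ 2 := by
  set T := euclLin M with hT
  have hadj : euclLin M.transpose = LinearMap.adjoint T := by
    rw [← Matrix.conjTranspose_eq_transpose_of_trivial]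
    exact Matrix.toEuclideanLin_conjTranspose_eq_adjoint M
  have hS := T.isSymmetric_adjoint_comp_self
  set b := hS.eigenvectorBasis rfl
  set e := hS.eigenvalues rfl
  have hrepr : ∀ i, b.repr ((LinearMap.adjoint T ∘ₗ T) v) i = e i * b.repr v i :=
    fun i => hS.eigenvectorBasis_apply_self_apply rfl v i
  have h1 : ‖T v‖ ^ 2 = ∑ i, e i * b.repr v i ^ 2 := by
    have : ‖T v‖ ^ 2 = inner ℝ ((LinearMap.adjoint T ∘ₗ T) v) v := by
      rw [LinearMap.comp_apply, LinearMap.adjoint_inner_left, real_inner_self_eq_norm_sq]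
    rw [this, ← b.repr.inner_map_map, PiLp.inner_apply]
    refine Finset.sum_congr rfl fun i _ => ?_
    rw [hrepr]
    simp
    ring
  have h2 : ‖LinearMap.adjoint T (T v)‖ ^ 2 = ∑ i, (e i * b.repr v i) ^ 2 := by
    rw [← LinearMap.comp_apply, ← b.repr.norm_map, EuclideanSpace.real_norm_sq_eq]
    exact Finset.sum_congr rfl fun i _ => by rw [hrepr]
  have h0 : 0 ≤ sigmaMin M := Real.sInf_nonneg fun s hs => by
    obtain ⟨_, k, rfl⟩ := hs
    exact T.singularValues_nonneg k
  rw [hadj, h1, h2, Finset.mul_sum]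
  refine Finset.sum_le_sum fun i _ => ?_
  have hsq : T.singularValues i ^ 2 = e i := T.sq_singularValues_fin rfl i
  by_cases hi : T.singularValues i = 0
  · rw [← hsq, hi]; simp
  · have hle : sigmaMin M ≤ T.singularValues i :=
      csInf_le ⟨0, fun s hs => by
        obtain ⟨_, k, rfl⟩ := hs
        exact T.singularValues_nonneg k⟩ ⟨hi, i, rfl⟩
    have : sigmaMin M ^ 2 ≤ e i := hsq ▸ pow_le_pow_left₀ h0 hle 2
    calc sigmaMin M ^ 2 * (e i * b.repr v i ^ 2) ≤ e i * (e i * b.repr v i ^ 2) :=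
          mul_le_mul_of_nonneg_right this
            (mul_nonneg (hsq ▸ sq_nonneg _) (sq_nonneg _))
      _ = _ := by ring

theorem sigmaMin_pos {m n : Type} [Fintype m] [Fintype n] [DecidableEq n]
    {M : Matrix m n ℝ} (hM : M ≠ 0) : 0 < sigmaMin M := by
  have hfin : {s : ℝ | s ≠ 0 ∧ s ∈ Set.range (euclLin M).singularValues}.Finite :=
    ((euclLin M).singularValues.finite_range).subset fun s hs => hs.2
  have hne : {s : ℝ | s ≠ 0 ∧ s ∈ Set.range (euclLin M).singularValues}.Nonempty := by
    by_contra hempty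
    rw [Set.not_nonempty_iff_eq_empty, Set.eq_empty_iff_forall_notMem] at hempty
    have h0 : (euclLin M).singularValues = 0 := by
      ext k
      by_contra hk
      exact hempty _ ⟨hk, k, rfl⟩
    rw [LinearMap.singularValues_eq_zero_iff] at h0
    exact hM ((LinearEquiv.map_eq_zero_iff (Matrix.toLpLin 2 2)).1 h0)
  obtain ⟨hs, k, hk⟩ := hne.csInf_mem hfin
  have h0 := (euclLin M).singularValues_nonneg k
  rw [hk] at h0
  exact lt_of_le_of_ne h0 (Ne.symm hs)

theorem sigmaMin_sq_mul_tinner_le [NeZero N₃] (A : Tensor N₁ N₂ N₃) (X : Tensor N₂ K N₃) :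
    sigmaMin (bcirc A) ^ 2 * tinner (tmul A X) (tmul A X) ≤
      tinner (tmul (ttrans A) (tmul A X)) (tmul (ttrans A) (tmul A X)) := by
  rw [tinner_self_eq_sum_col, tinner_self_eq_sum_col, Finset.mul_sum]
  refine Finset.sum_le_sum fun j _ => ?_
  rw [col_tmul, col_tmul, bcirc_ttrans]
  exact sigmaMin_sq_mul_norm_sq_le _ _

end Algebra

/-! ### The subdifferential of the sparse objective -/

section Convex

variable {N₁ N₂ N₃ K : ℕ} {lam : ℝ}

/-- Entrywise form of `Z ∈ ∂f(X)` for `f = ‖·‖_F² / 2 + lam ‖·‖₁`: each entry of `Z - X` is a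
subgradient of `lam |·|` at the corresponding entry of `X`. -/
def IsEntrywiseSubgrad (lam : ℝ) (X Z : Tensor N₁ N₂ N₃) : Prop :=
  ∀ i j k, |Z i j k - X i j k| ≤ lam ∧ (Z i j k - X i j k) * X i j k = lam * |X i j k|

theorem sparseObj_eq_sum (lam : ℝ) (X : Tensor N₁ N₂ N₃) :
    sparseObj lam X = ∑ i, ∑ j, ∑ k, (1 / 2 * X i j k ^ 2 + lam * |X i j k|) := by
  simp only [sparseObj, frobNorm_sq, tinner, oneNorm, Finset.mul_sum, Finset.sum_add_distrib, pow_two (X _ _ _)]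

/-- Strong convexity of the objective, with modulus 1. -/
theorem IsEntrywiseSubgrad.sparseObj_le {X Z : Tensor N₁ N₂ N₃}
    (h : IsEntrywiseSubgrad lam X Z) (Y : Tensor N₁ N₂ N₃) :
    sparseObj lam X + tinner Z (Y - X) + 1 / 2 * tinner (Y - X) (Y - X) ≤ sparseObj lam Y := by
  simp only [sparseObj_eq_sum, tinner, Finset.mul_sum, ← Finset.sum_add_distrib]
  refine Finset.sum_le_sum fun i _ => Finset.sum_le_sum fun j _ => Finset.sum_le_sum fun k _ => ?_
  obtain ⟨h1, h2⟩ := h i j k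
  have h3 : (Z i j k - X i j k) * Y i j k ≤ lam * |Y i j k| :=
    (le_abs_self _).trans (by rw [abs_mul]; exact mul_le_mul_of_nonneg_right h1 (abs_nonneg _))
  simp only [Pi.sub_apply]
  nlinarith [h2, h3]

theorem IsEntrywiseSubgrad.mem_subdiff {X Z : Tensor N₁ N₂ N₃}
    (h : IsEntrywiseSubgrad lam X Z) : Z ∈ subdiff (sparseObj lam) X := fun Y => by
  have := h.sparseObj_le Y
  have := tinner_self_nonneg (Y - X)
  linarith

theorem isEntrywiseSubgrad_softShrink (hlam : 0 ≤ lam) (Y : Tensor N₁ N₂ N₃) :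
    IsEntrywiseSubgrad lam (softShrink lam Y) Y := by
  intro i j k
  simp only [softShrink]
  generalize Y i j k = y
  rcases lt_trichotomy y 0 with hy | rfl | hy
  · rw [Real.sign_of_neg hy, abs_of_neg hy]
    rcases le_total (-y - lam) 0 with h | h
    · rw [max_eq_right h]
      exact ⟨by rw [abs_le]; constructor <;> linarith, by simp⟩
    · rw [max_eq_left h]
      refine ⟨by rw [abs_le]; constructor <;> linarith, ?_⟩
      rw [abs_of_nonpos (by linarith)]; ring
  · simpa using hlam
  · rw [Real.sign_of_pos hy, abs_of_pos hy]
    rcases le_total (y - lam) 0 with h | h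
    · rw [max_eq_right h]
      exact ⟨by rw [abs_le]; constructor <;> linarith, by simp⟩
    · rw [max_eq_left h]
      refine ⟨by rw [abs_le]; constructor <;> linarith, ?_⟩
      rw [abs_of_nonneg (by linarith)]; ring

theorem mem_subdiff_softShrink (hlam : 0 ≤ lam) (Y : Tensor N₁ N₂ N₃) :
    Y ∈ subdiff (sparseObj lam) (softShrink lam Y) :=
  (isEntrywiseSubgrad_softShrink hlam Y).mem_subdiff

theorem eq_softShrink_of_mem_subdiff (hlam : 0 ≤ lam) {X Z : Tensor N₁ N₂ N₃}
    (h : Z ∈ subdiff (sparseObj lam) X) : X = softShrink lam Z := by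
  have h1 := h (softShrink lam Z)
  have h2 := (isEntrywiseSubgrad_softShrink hlam Z).sparseObj_le X
  have h3 := tinner_self_nonneg (X - softShrink lam Z)
  simp only [tinner_sub_right Z] at h1 h2
  exact sub_eq_zero.1 (eq_zero_of_tinner_self (by linarith))

theorem isEntrywiseSubgrad_of_mem_subdiff (hlam : 0 ≤ lam) {X Z : Tensor N₁ N₂ N₃}
    (h : Z ∈ subdiff (sparseObj lam) X) : IsEntrywiseSubgrad lam X Z := by
  rw [eq_softShrink_of_mem_subdiff hlam h]
  exact isEntrywiseSubgrad_softShrink hlam Z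

theorem half_tinner_le_bregman (hlam : 0 ≤ lam) {X Z : Tensor N₁ N₂ N₃}
    (h : Z ∈ subdiff (sparseObj lam) X) (Y : Tensor N₁ N₂ N₃) :
    1 / 2 * tinner (X - Y) (X - Y) ≤ bregman (sparseObj lam) Z X Y := by
  have := (isEntrywiseSubgrad_of_mem_subdiff hlam h).sparseObj_le Y
  rw [← neg_sub Y X, tinner_neg_left, tinner_neg_right, neg_neg, bregman]
  linarith

/-- The two Bregman distances between two points add up to an inner product; dropping one of them
gives this bound. -/
theorem bregman_le_tinner {f : Tensor N₁ N₂ N₃ → ℝ} {X Y Z W : Tensor N₁ N₂ N₃}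
    (hW : W ∈ subdiff f Y) : bregman f Z X Y ≤ tinner (Z - W) (X - Y) := by
  have := hW X
  rw [bregman, tinner_sub_left, ← neg_sub X Y, tinner_neg_right]
  linarith

/-! ### Existence, uniqueness and optimality conditions of the constrained minimizer -/

theorem continuous_sparseObj (lam : ℝ) :
    Continuous (sparseObj lam : Tensor N₁ N₂ N₃ → ℝ) := by
  rw [funext (sparseObj_eq_sum lam)]
  fun_prop

theorem tinner_self_le_two_mul_sparseObj (hlam : 0 ≤ lam) (X : Tensor N₁ N₂ N₃) :
    tinner X X ≤ 2 * sparseObj lam X := by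
  have : 0 ≤ oneNorm X := Finset.sum_nonneg fun _ _ => Finset.sum_nonneg fun _ _ =>
    Finset.sum_nonneg fun _ _ => abs_nonneg _
  have := mul_nonneg hlam this
  rw [sparseObj, frobNorm_sq]
  linarith

theorem continuous_tmul (A : Tensor N₁ N₂ N₃) :
    Continuous fun X : Tensor N₂ K N₃ => tmul A X := by
  refine continuous_pi fun i => continuous_pi fun j => continuous_pi fun k => ?_
  simp only [tmul_apply]
  fun_prop

variable [NeZero N₃]

theorem isFeasible_iff (A : Tensor N₁ N₂ N₃) (B : Tensor N₁ K N₃) (X : Tensor N₂ K N₃) :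
    IsFeasible A B X ↔ tmul (ttrans A) (B - tmul A X) = 0 := by
  rw [IsFeasible, tmul_assoc, tmul_sub, sub_eq_zero, eq_comm]

theorem isFeasible_tpinv (A : Tensor N₁ N₂ N₃) (B : Tensor N₁ K N₃) :
    IsFeasible A B (tmul (tpinv A) B) := by
  rw [IsFeasible, tmul_assoc, ← tmul_assoc A, ← tmul_assoc, ttrans_tmul_tmul_tpinv]

theorem IsFeasible.tmul_sub_eq_zero {A : Tensor N₁ N₂ N₃} {B : Tensor N₁ K N₃}
    {X Y : Tensor N₂ K N₃} (hX : IsFeasible A B X) (hY : IsFeasible A B Y) :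
    tmul A (X - Y) = 0 := by
  refine tmul_eq_zero_of_ttrans_tmul ?_
  rw [← tmul_assoc, tmul_sub, hX, hY, sub_self]

theorem IsFeasible.add_of_tmul_eq_zero {A : Tensor N₁ N₂ N₃} {B : Tensor N₁ K N₃}
    {X D : Tensor N₂ K N₃} (hX : IsFeasible A B X) (hD : tmul A D = 0) :
    IsFeasible A B (X + D) := by
  rw [IsFeasible, tmul_add, hX, tmul_assoc, hD, tmul_zero, add_zero]

/-- Every feasible `X` has `A * X = A * A† * B`. -/
theorem IsFeasible.tmul_eq {A : Tensor N₁ N₂ N₃} {B : Tensor N₁ K N₃}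
    {X : Tensor N₂ K N₃} (hX : IsFeasible A B X) : tmul A X = tmul (tmul A (tpinv A)) B := by
  have := hX.tmul_sub_eq_zero (isFeasible_tpinv A B)
  rw [tmul_sub, sub_eq_zero] at this
  rw [this, tmul_assoc]

theorem exists_isSparseSolution (A : Tensor N₁ N₂ N₃) (B : Tensor N₁ K N₃) (hlam : 0 ≤ lam) :
    ∃ X, IsSparseSolution A B lam X := by
  have hX₀ := isFeasible_tpinv A B
  set X₀ := tmul (tpinv A) B
  set R := Real.sqrt (2 * sparseObj lam X₀)
  set S : Set (Tensor N₂ K N₃) :=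
    {X | IsFeasible A B X} ∩ {X | sparseObj lam X ≤ sparseObj lam X₀} with hS
  have hcl : IsClosed S :=
    (isClosed_eq (continuous_tmul (tmul (ttrans A) A)) continuous_const).inter
      (isClosed_le (continuous_sparseObj lam) continuous_const)
  have hbd : S ⊆ Set.Icc (fun _ _ _ => -R) (fun _ _ _ => R) := by
    intro X hX
    have habs : ∀ i j k, |X i j k| ≤ R := fun i j k => Real.abs_le_sqrt <|
      (sq_entry_le_tinner_self X i j k).trans <|
        (tinner_self_le_two_mul_sparseObj hlam X).trans (by have := hX.2; simp at this; linarith)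
    exact ⟨fun i j k => (abs_le.1 (habs i j k)).1, fun i j k => (abs_le.1 (habs i j k)).2⟩
  have hcomp : IsCompact S := isCompact_Icc.of_isClosed_subset hcl hbd
  obtain ⟨X, hX, hmin⟩ := hcomp.exists_isMinOn ⟨X₀, hX₀, le_refl (sparseObj lam X₀)⟩
    (continuous_sparseObj lam).continuousOn
  refine ⟨X, hX.1, fun X' hX' => ?_⟩
  by_cases h : sparseObj lam X' ≤ sparseObj lam X₀
  · exact hmin (show X' ∈ S from ⟨hX', h⟩)
  · exact le_trans hX.2 (not_le.1 h).le

/-- The directional derivative of `x ^ 2 / 2 + lam |x|` at `x` in direction `d`. -/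
def scalarDirDeriv (lam x d : ℝ) : ℝ :=
  x * d + if x = 0 then lam * |d| else lam * (Real.sign x * d)

omit [NeZero N₃] in
theorem eventually_scalar_expansion (lam x d : ℝ) : ∀ᶠ t in nhdsWithin (0 : ℝ) (Set.Ioi 0),
    1 / 2 * (x + t * d) ^ 2 + lam * |x + t * d| =
      1 / 2 * x ^ 2 + lam * |x| + (t * scalarDirDeriv lam x d + 1 / 2 * t ^ 2 * (d * d)) := by
  have hc : Filter.Tendsto (fun t : ℝ => x + t * d) (nhdsWithin 0 (Set.Ioi 0)) (nhds x) := by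
    have : Continuous fun t : ℝ => x + t * d := by fun_prop
    simpa using (this.tendsto 0).mono_left nhdsWithin_le_nhds
  rcases lt_trichotomy x 0 with hx | rfl | hx
  · filter_upwards [hc.eventually_lt_const hx] with t ht
    rw [scalarDirDeriv, if_neg hx.ne, Real.sign_of_neg hx, abs_of_neg hx, abs_of_neg ht]
    ring
  · filter_upwards [self_mem_nhdsWithin] with t ht
    rw [scalarDirDeriv, if_pos rfl, zero_add, abs_mul, abs_of_pos (Set.mem_Ioi.1 ht), abs_zero]
    ring
  · filter_upwards [hc.eventually_const_lt hx] with t ht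
    rw [scalarDirDeriv, if_neg hx.ne', Real.sign_of_pos hx, abs_of_pos hx, abs_of_pos ht]
    ring

omit [NeZero N₃] in
theorem eventually_sparseObj_expansion (lam : ℝ) (X D : Tensor N₁ N₂ N₃) :
    ∀ᶠ t in nhdsWithin (0 : ℝ) (Set.Ioi 0), sparseObj lam (X + t • D) = sparseObj lam X +
      (t * (∑ i, ∑ j, ∑ k, scalarDirDeriv lam (X i j k) (D i j k))
        + 1 / 2 * t ^ 2 * tinner D D) := by
  have h : ∀ᶠ t in nhdsWithin (0 : ℝ) (Set.Ioi 0), ∀ i j k, _ :=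
    Filter.eventually_all.2 fun i => Filter.eventually_all.2 fun j => Filter.eventually_all.2
      fun k => eventually_scalar_expansion lam (X i j k) (D i j k)
  filter_upwards [h] with t ht
  simp only [sparseObj_eq_sum, tinner, Finset.mul_sum, ← Finset.sum_add_distrib]
  exact Finset.sum_congr rfl fun i _ => Finset.sum_congr rfl fun j _ =>
    Finset.sum_congr rfl fun k _ => ht i j k

omit [NeZero N₃] in
theorem exists_tinner_eq (g : Tensor N₁ N₂ N₃ →ₗ[ℝ] ℝ) :
    ∃ Z : Tensor N₁ N₂ N₃, (∀ D, g D = tinner Z D) ∧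
      ∀ i j k, Z i j k = g (Pi.single i (Pi.single j (Pi.single k 1))) := by
  refine ⟨fun i j k => g (Pi.single i (Pi.single j (Pi.single k 1))), fun D => ?_,
    fun _ _ _ => rfl⟩
  have hD : D = ∑ i, ∑ j, ∑ k, D i j k •
      (Pi.single i (Pi.single j (Pi.single k 1)) : Tensor N₁ N₂ N₃) := by
    funext i j k
    simp [Finset.sum_apply, Pi.single_apply, ite_apply]
  conv_lhs => rw [hD]
  simp only [map_sum, map_smul, smul_eq_mul, tinner, mul_comm]

/-- The optimality condition: at a minimizer some subgradient lies in the range of `Aᵀ`. The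
directional derivative of `f` is nonnegative on the kernel of `A`; by Hahn-Banach it dominates a
linear functional that vanishes there. -/
theorem IsSparseSolution.exists_mem_subdiff {A : Tensor N₁ N₂ N₃} {B : Tensor N₁ K N₃}
    {X : Tensor N₂ K N₃} (hlam : 0 ≤ lam) (hX : IsSparseSolution A B lam X) :
    ∃ Z ∈ rangeK K (ttrans A), Z ∈ subdiff (sparseObj lam) X := by
  let kerA : Submodule ℝ (Tensor N₂ K N₃) :=
    { carrier := {D | tmul A D = 0}
      add_mem' := fun {D E} hD hE => by
        simp only [Set.mem_ofPred_eq] at hD hE ⊢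
        rw [tmul_add, hD, hE, add_zero]
      zero_mem' := tmul_zero A
      smul_mem' := fun c D hD => by
        simp only [Set.mem_ofPred_eq] at hD ⊢
        rw [tmul_smul, hD, smul_zero] }
  let p : Tensor N₂ K N₃ → ℝ := fun D => ∑ i, ∑ j, ∑ k, scalarDirDeriv lam (X i j k) (D i j k)
  have hp_nonneg : ∀ D, tmul A D = 0 → 0 ≤ p D := by
    intro D hD
    have hlim : Filter.Tendsto (fun t : ℝ => p D + 1 / 2 * t * tinner D D)
        (nhdsWithin 0 (Set.Ioi 0)) (nhds (p D)) := by
      have : Continuous fun t : ℝ => p D + 1 / 2 * t * tinner D D := by fun_prop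
      simpa using (this.tendsto 0).mono_left nhdsWithin_le_nhds
    refine ge_of_tendsto hlim ?_
    filter_upwards [eventually_sparseObj_expansion lam X D, self_mem_nhdsWithin] with t ht htpos
    have htpos : 0 < t := htpos
    have hle := hX.2 (X + t • D)
      (hX.1.add_of_tmul_eq_zero (by rw [tmul_smul, hD, smul_zero]))
    rw [ht] at hle
    refine nonneg_of_mul_nonneg_right (a := t) ?_ htpos
    have e : t * (p D + 1 / 2 * t * tinner D D) = t * p D + 1 / 2 * t ^ 2 * tinner D D := by ring
    rw [e]
    linarith
  obtain ⟨g, hg0, hgp⟩ := exists_extension_of_le_sublinear ⟨kerA, 0⟩ p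
    (fun c hc D => by
      simp only [p, Finset.mul_sum, Pi.smul_apply, smul_eq_mul]
      refine Finset.sum_congr rfl fun i _ => Finset.sum_congr rfl fun j _ =>
        Finset.sum_congr rfl fun k _ => ?_
      unfold scalarDirDeriv
      rw [abs_mul, abs_of_pos hc]
      split_ifs <;> ring)
    (fun D E => by
      simp only [p, ← Finset.sum_add_distrib, Pi.add_apply]
      refine Finset.sum_le_sum fun i _ => Finset.sum_le_sum fun j _ =>
        Finset.sum_le_sum fun k _ => ?_
      unfold scalarDirDeriv
      have := mul_le_mul_of_nonneg_left (abs_add_le (D i j k) (E i j k)) hlam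
      split_ifs <;> linarith)
    (fun D => hp_nonneg D D.2)
  obtain ⟨Z, hZ, hZe⟩ := exists_tinner_eq g
  refine ⟨Z, mem_rangeK_ttrans fun D hD => ?_, ?_⟩
  · rw [← hZ]
    exact hg0 ⟨D, hD⟩
  · refine IsEntrywiseSubgrad.mem_subdiff fun i j k => ?_
    -- testing `g ≤ p` on multiples of a coordinate tensor isolates one entry
    have hs : ∀ s : ℝ, s * Z i j k ≤ scalarDirDeriv lam (X i j k) s := by
      intro s
      have := hgp (s • Pi.single i (Pi.single j (Pi.single k 1)))
      rw [map_smul, ← hZe, smul_eq_mul] at this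
      refine this.trans_eq ?_
      simp only [p]
      rw [Fintype.sum_eq_single i, Fintype.sum_eq_single j, Fintype.sum_eq_single k]
      · simp
      · intro k' hk'; simp [scalarDirDeriv, hk']
      · intro j' hj'; simp [scalarDirDeriv, hj']
      · intro i' hi'; simp [scalarDirDeriv, hi']
    have h1 := hs 1
    have h2 := hs (-1)
    unfold scalarDirDeriv at h1 h2
    rcases lt_trichotomy (X i j k) 0 with hx | hx | hx
    · rw [if_neg hx.ne, Real.sign_of_neg hx] at h1 h2
      have : Z i j k - X i j k = -lam := by linarith
      rw [this, abs_of_neg hx, abs_neg, abs_of_nonneg hlam]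
      exact ⟨le_rfl, by ring⟩
    · rw [if_pos hx] at h1 h2
      simp only [abs_neg, abs_one, hx] at h1 h2 ⊢
      exact ⟨abs_le.2 ⟨by linarith, by linarith⟩, by simp⟩
    · rw [if_neg hx.ne', Real.sign_of_pos hx] at h1 h2
      have : Z i j k - X i j k = lam := by linarith
      rw [this, abs_of_pos hx, abs_of_nonneg hlam]
      exact ⟨le_rfl, by ring⟩

theorem IsSparseSolution.unique {A : Tensor N₁ N₂ N₃} {B : Tensor N₁ K N₃}
    {X Y : Tensor N₂ K N₃} (hlam : 0 ≤ lam) (hX : IsSparseSolution A B lam X)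
    (hY : IsSparseSolution A B lam Y) : Y = X := by
  obtain ⟨Z, ⟨W, hW⟩, hZ⟩ := hX.exists_mem_subdiff hlam
  dsimp only at hW
  have h1 := (isEntrywiseSubgrad_of_mem_subdiff hlam hZ).sparseObj_le Y
  have h2 := hY.2 X hX.1
  have h3 : tinner Z (Y - X) = 0 := by
    rw [← hW, tinner_tmul_ttrans_left, hY.1.tmul_sub_eq_zero hX.1, tinner_zero_right]
  have h4 := tinner_self_nonneg (Y - X)
  exact sub_eq_zero.1 (eq_zero_of_tinner_self (by linarith))

end Convex

/-! ### A Hoffman bound for a subspace and a box -/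

section Hoffman

variable {ι : Type*} [Fintype ι]

/-- On the polar, within the subspace `R`, of the cone
`{d ∈ R | d ≤ 0 on U, 0 ≤ d on L}`, the violation of the cone constraints controls the norm:
the violation vanishes only on the cone, which meets its polar in `0`, and the unit sphere is
compact. -/
theorem exists_norm_le_violation_of_polar (R : Submodule ℝ (EuclideanSpace ℝ ι))
    (U L : Finset ι) :
    ∃ C : ℝ, 0 ≤ C ∧ ∀ d ∈ R,
      (∀ d' ∈ R, (∀ i ∈ U, d' i ≤ 0) → (∀ i ∈ L, 0 ≤ d' i) → inner ℝ d d' ≤ 0) →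
      ‖d‖ ≤ C * (∑ i ∈ U, max (d i) 0 + ∑ i ∈ L, max (-d i) 0) := by
  set T : Set (EuclideanSpace ℝ ι) :=
    {d' | d' ∈ R ∧ (∀ i ∈ U, d' i ≤ 0) ∧ (∀ i ∈ L, 0 ≤ d' i)} with hT
  set v : EuclideanSpace ℝ ι → ℝ :=
    fun d => ∑ i ∈ U, max (d i) 0 + ∑ i ∈ L, max (-d i) 0 with hv
  have hvc : Continuous v := by fun_prop
  set S : Set (EuclideanSpace ℝ ι) :=
    Metric.sphere 0 1 ∩ ((R : Set (EuclideanSpace ℝ ι)) ∩ ⋂ d' ∈ T, {d | inner ℝ d d' ≤ 0}) with hS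
  have hScomp : IsCompact S := (isCompact_sphere 0 1).inter_right
    (R.closed_of_finiteDimensional.inter (isClosed_biInter fun d' _ =>
      isClosed_le (by fun_prop) continuous_const))
  have hvS : ∀ d ∈ S, 0 < v d := by
    rintro d ⟨hd1, hdR, hdT⟩
    have h1 : ∀ i ∈ U, 0 ≤ max (d i) 0 := fun _ _ => le_max_right _ _
    have h2 : ∀ i ∈ L, 0 ≤ max (-d i) 0 := fun _ _ => le_max_right _ _
    refine lt_of_le_of_ne (add_nonneg (Finset.sum_nonneg h1) (Finset.sum_nonneg h2)) fun h0 => ?_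
    obtain ⟨hU, hL⟩ :=
      (add_eq_zero_iff_of_nonneg (Finset.sum_nonneg h1) (Finset.sum_nonneg h2)).1 h0.symm
    rw [Finset.sum_eq_zero_iff_of_nonneg h1] at hU
    rw [Finset.sum_eq_zero_iff_of_nonneg h2] at hL
    have hdmem : d ∈ T := ⟨hdR, fun i hi => max_eq_right_iff.1 (hU i hi),
      fun i hi => by have := max_eq_right_iff.1 (hL i hi); linarith⟩
    have hle : inner ℝ d d ≤ 0 := Set.mem_iInter₂.1 hdT d hdmem
    rw [real_inner_self_eq_norm_sq, mem_sphere_zero_iff_norm.1 hd1] at hle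
    norm_num at hle
  obtain ⟨c, hc, hcS⟩ : ∃ c : ℝ, 0 < c ∧ ∀ d ∈ S, c ≤ v d := by
    rcases S.eq_empty_or_nonempty with h | h
    · exact ⟨1, one_pos, fun d hd => by rw [h] at hd; exact hd.elim⟩
    · obtain ⟨d, hd, hmin⟩ := hScomp.exists_isMinOn h hvc.continuousOn
      exact ⟨v d, hvS d hd, fun d' hd' => hmin hd'⟩
  refine ⟨1 / c, by positivity, fun d hdR hdT => ?_⟩
  rcases eq_or_ne d 0 with rfl | hd0
  · simp
  have hn : 0 < ‖d‖ := norm_pos_iff.2 hd0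
  have hmem : ‖d‖⁻¹ • d ∈ S := by
    refine ⟨?_, R.smul_mem _ hdR, Set.mem_iInter₂.2 fun d' hd' => ?_⟩
    · rw [mem_sphere_zero_iff_norm, norm_smul, norm_inv, norm_norm, inv_mul_cancel₀ hn.ne']
    · change inner ℝ (‖d‖⁻¹ • d) d' ≤ 0
      rw [real_inner_smul_left]
      exact mul_nonpos_of_nonneg_of_nonpos (by positivity) (hdT d' hd'.1 hd'.2.1 hd'.2.2)
  have hhom : v (‖d‖⁻¹ • d) = ‖d‖⁻¹ * v d := by
    have hm : ∀ x : ℝ, max (‖d‖⁻¹ * x) 0 = ‖d‖⁻¹ * max x 0 := fun x => by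
      rw [mul_max_of_nonneg _ _ (by positivity), mul_zero]
    simp only [hv, PiLp.smul_apply, smul_eq_mul, ← mul_neg, hm, mul_add, Finset.mul_sum]
  have := hcS _ hmem
  rw [hhom, inv_mul_eq_div, le_div_iff₀ hn] at this
  rw [one_div, inv_mul_eq_div, le_div_iff₀ hc]
  linarith

/-- **Hoffman bound**: the distance of a point of the subspace `R` to the intersection of `R` with
a box is at most a constant times the violation of the box constraints. The projection residual
lies in the polar of a cone that depends only on which box constraints are active, so finitely many
constants suffice. -/
theorem exists_dist_subspace_inter_box_le (R : Submodule ℝ (EuclideanSpace ℝ ι)) (lo hi : ι → ℝ)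
    (hne : ∃ p ∈ R, ∀ i, lo i ≤ p i ∧ p i ≤ hi i) :
    ∃ C : ℝ, 0 ≤ C ∧ ∀ z ∈ R, ∃ p ∈ R, (∀ i, lo i ≤ p i ∧ p i ≤ hi i) ∧
      ‖z - p‖ ≤ C * ∑ i, (max (z i - hi i) 0 + max (lo i - z i) 0) := by
  classical
  choose C hC0 hC using exists_norm_le_violation_of_polar R
  refine ⟨∑ U, ∑ L, C U L, Finset.sum_nonneg fun _ _ => Finset.sum_nonneg fun _ _ => hC0 _ _,
    fun z hz => ?_⟩
  set Q : Set (EuclideanSpace ℝ ι) := {p | p ∈ R ∧ ∀ i, lo i ≤ p i ∧ p i ≤ hi i} with hQ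
  have hQne : Q.Nonempty := by
    obtain ⟨p, hp, hp'⟩ := hne
    exact ⟨p, hp, hp'⟩
  have hQeq : Q = (R : Set (EuclideanSpace ℝ ι)) ∩ ⋂ i, {p | lo i ≤ p i ∧ p i ≤ hi i} := by
    ext p
    simp [hQ]
  have hQcl : IsClosed Q := by
    rw [hQeq]
    refine R.closed_of_finiteDimensional.inter (isClosed_iInter fun i => ?_)
    have hcont : Continuous fun p : EuclideanSpace ℝ ι => p i := by fun_prop
    exact (isClosed_le continuous_const hcont).inter (isClosed_le hcont continuous_const)
  have hQconv : Convex ℝ Q := by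
    intro p hp q hq a b ha hb hab
    refine ⟨R.add_mem (R.smul_mem _ hp.1) (R.smul_mem _ hq.1), fun i => ?_⟩
    have h1 := hp.2 i
    have h2 := hq.2 i
    have e1 : lo i = a * lo i + b * lo i := by rw [← add_mul, hab, one_mul]
    have e2 : hi i = a * hi i + b * hi i := by rw [← add_mul, hab, one_mul]
    simp only [PiLp.add_apply, PiLp.smul_apply, smul_eq_mul]
    rw [e1, e2]
    constructor <;> gcongr <;> tauto
  obtain ⟨p, hpQ, hp⟩ := exists_norm_eq_iInf_of_complete_convex hQne hQcl.isComplete hQconv z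
  rw [norm_eq_iInf_iff_real_inner_le_zero hQconv hpQ] at hp
  refine ⟨p, hpQ.1, hpQ.2, ?_⟩
  set U : Finset ι := Finset.univ.filter fun i => p i = hi i with hU
  set L : Finset ι := Finset.univ.filter fun i => p i = lo i with hL
  have hpolar : ∀ d' ∈ R, (∀ i ∈ U, d' i ≤ 0) → (∀ i ∈ L, 0 ≤ d' i) →
      inner ℝ (z - p) d' ≤ 0 := by
    intro d' hd' hdU hdL
    -- a short step from `p` in the direction `d'` stays in the box
    have hstep : ∀ᶠ t in nhdsWithin (0 : ℝ) (Set.Ioi 0),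
        ∀ i, lo i ≤ p i + t * d' i ∧ p i + t * d' i ≤ hi i := by
      refine Filter.eventually_all.2 fun i => ?_
      have hc : Filter.Tendsto (fun t : ℝ => p i + t * d' i) (nhdsWithin 0 (Set.Ioi 0))
          (nhds (p i)) := by
        have : Continuous fun t : ℝ => p i + t * d' i := by fun_prop
        simpa using (this.tendsto 0).mono_left nhdsWithin_le_nhds
      have hlo : ∀ᶠ t in nhdsWithin (0 : ℝ) (Set.Ioi 0), lo i ≤ p i + t * d' i := by
        by_cases h : p i = lo i
        · have := hdL i (by simp [hL, h])
          filter_upwards [self_mem_nhdsWithin] with t ht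
          have := mul_nonneg (le_of_lt (Set.mem_Ioi.1 ht)) this
          linarith
        · exact (hc.eventually_const_lt (lt_of_le_of_ne (hpQ.2 i).1 (Ne.symm h))).mono
            fun _ h => h.le
      have hhi : ∀ᶠ t in nhdsWithin (0 : ℝ) (Set.Ioi 0), p i + t * d' i ≤ hi i := by
        by_cases h : p i = hi i
        · have := hdU i (by simp [hU, h])
          filter_upwards [self_mem_nhdsWithin] with t ht
          have := mul_nonpos_of_nonneg_of_nonpos (le_of_lt (Set.mem_Ioi.1 ht)) this
          linarith
        · exact (hc.eventually_lt_const (lt_of_le_of_ne (hpQ.2 i).2 h)).mono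
            fun _ h => h.le
      exact hlo.and hhi
    obtain ⟨t, ht, htpos⟩ := (hstep.and self_mem_nhdsWithin).exists
    have htpos : 0 < t := htpos
    have := hp (p + t • d') ⟨R.add_mem hpQ.1 (R.smul_mem _ hd'), fun i => by simpa using ht i⟩
    rw [add_sub_cancel_left, real_inner_smul_right] at this
    exact nonpos_of_mul_nonpos_right this htpos
  have hbound := hC U L (z - p) (R.sub_mem hz hpQ.1) hpolar
  have hviol : ∑ i ∈ U, max ((z - p) i) 0 + ∑ i ∈ L, max (-(z - p) i) 0 ≤
      ∑ i, (max (z i - hi i) 0 + max (lo i - z i) 0) := by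
    rw [Finset.sum_add_distrib]
    refine add_le_add ?_ ?_
    · rw [Finset.sum_congr rfl (g := fun i => max (z i - hi i) 0) fun i hi' => by
        rw [PiLp.sub_apply, (Finset.mem_filter.1 hi').2]]
      exact Finset.sum_le_sum_of_subset_of_nonneg (Finset.subset_univ _)
        fun _ _ _ => le_max_right _ _
    · rw [Finset.sum_congr rfl (g := fun i => max (lo i - z i) 0) fun i hi' => by
        rw [PiLp.sub_apply, (Finset.mem_filter.1 hi').2, neg_sub]]
      exact Finset.sum_le_sum_of_subset_of_nonneg (Finset.subset_univ _)
        fun _ _ _ => le_max_right _ _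
  have hCle : C U L ≤ ∑ U, ∑ L, C U L :=
    (Finset.single_le_sum (f := fun L => C U L) (fun L _ => hC0 U L) (Finset.mem_univ L)).trans
      (Finset.single_le_sum (f := fun U => ∑ L, C U L)
        (fun U _ => Finset.sum_nonneg fun L _ => hC0 U L) (Finset.mem_univ U))
  have hv0 : 0 ≤ ∑ i, (max (z i - hi i) 0 + max (lo i - z i) 0) :=
    Finset.sum_nonneg fun _ _ => add_nonneg (le_max_right _ _) (le_max_right _ _)
  exact hbound.trans ((mul_le_mul_of_nonneg_left hviol (hC0 U L)).trans
    (mul_le_mul_of_nonneg_right hCle hv0))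

end Hoffman

/-! ### The error bound -/

section ErrorBound

variable {N₁ N₂ N₃ K : ℕ} {lam : ℝ}

theorem zero_mem_rangeK (A : Tensor N₁ N₂ N₃) : (0 : Tensor N₁ K N₃) ∈ rangeK K A :=
  ⟨0, tmul_zero A⟩

theorem add_mem_rangeK {A : Tensor N₁ N₂ N₃} {X Y : Tensor N₁ K N₃} (hX : X ∈ rangeK K A)
    (hY : Y ∈ rangeK K A) : X + Y ∈ rangeK K A := by
  obtain ⟨V, rfl⟩ := hX
  obtain ⟨W, rfl⟩ := hY
  exact ⟨V + W, tmul_add A V W⟩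

theorem smul_mem_rangeK {A : Tensor N₁ N₂ N₃} (c : ℝ) {X : Tensor N₁ K N₃}
    (hX : X ∈ rangeK K A) : c • X ∈ rangeK K A := by
  obtain ⟨V, rfl⟩ := hX
  exact ⟨c • V, tmul_smul A c V⟩

theorem sub_mem_rangeK {A : Tensor N₁ N₂ N₃} {X Y : Tensor N₁ K N₃} (hX : X ∈ rangeK K A)
    (hY : Y ∈ rangeK K A) : X - Y ∈ rangeK K A := by
  rw [sub_eq_add_neg, ← neg_one_smul ℝ Y]
  exact add_mem_rangeK hX (smul_mem_rangeK _ hY)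

/-- For a subgradient `z` at `x`, the violation of `[-lam, lam]`, the subdifferential at `0`, is at
most the distance of `x` to `0`. -/
theorem violation_le_of_zero {x z : ℝ} (hlam : 0 ≤ lam) (h : |z - x| ≤ lam) :
    max (z - lam) 0 + max (-lam - z) 0 ≤ |x| := by
  obtain ⟨h1, h2⟩ := abs_le.1 h
  have := le_abs_self x
  have := neg_abs_le x
  have := abs_nonneg x
  rcases le_total (z - lam) 0 with h3 | h3 <;> rcases le_total (-lam - z) 0 with h4 | h4 <;>
    simp only [max_eq_left h3, max_eq_right h3, max_eq_left h4, max_eq_right h4] <;> linarith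

/-- At `y ≠ 0` the subdifferential is a single point `w`. A subgradient at `x` differs from `w` by
`x - y`, up to a sign jump of size `2 * lam`, which takes place only if `|x - y| ≥ |y|`. -/
theorem violation_le_of_ne_zero {x z y w : ℝ} (hy : y ≠ 0)
    (h : |z - x| ≤ lam ∧ (z - x) * x = lam * |x|)
    (h' : |w - y| ≤ lam ∧ (w - y) * y = lam * |y|) :
    |z - w| ≤ (1 + 2 * lam / |y|) * |x - y| := by
  have hy0 : 0 < |y| := abs_pos.2 hy
  have hlam : 0 ≤ lam := (abs_nonneg _).trans h.1
  have hsgn : ∀ {s t : ℝ}, s * t = lam * |t| → t ≠ 0 → s = lam * (|t| / t) := by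
    intro s t hst ht
    field_simp
    linarith
  have htri : |z - w| ≤ |x - y| + |(z - x) - (w - y)| := by
    have : z - w = (x - y) + ((z - x) - (w - y)) := by ring
    rw [this]
    exact abs_add_le _ _
  by_cases hxy : 0 < x * y
  · have hx : x ≠ 0 := fun h0 => by simp [h0] at hxy
    have e : |x| / x = |y| / y := by
      rcases pos_and_pos_or_neg_and_neg_of_mul_pos hxy with ⟨h1, h2⟩ | ⟨h1, h2⟩
      · rw [abs_of_pos h1, abs_of_pos h2, div_self hx, div_self hy]
      · rw [abs_of_neg h1, abs_of_neg h2, neg_div, neg_div, div_self hx, div_self hy]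
    rw [hsgn h.2 hx, hsgn h'.2 hy, e, sub_self, abs_zero, add_zero] at htri
    have : 0 ≤ 2 * lam / |y| * |x - y| := by positivity
    linarith
  · -- the signs differ, so that `x` is at least `|y|` away from `y`
    have h1 : |y| ≤ |x - y| := by
      rw [← sq_le_sq]
      nlinarith [sq_nonneg x]
    have h2 : |(z - x) - (w - y)| ≤ 2 * lam :=
      (abs_sub _ _).trans (by linarith [h.1, h'.1])
    have h3 : 2 * lam ≤ 2 * lam / |y| * |x - y| := by
      rw [div_mul_eq_mul_div, le_div_iff₀ hy0]
      exact mul_le_mul_of_nonneg_left h1 (by positivity)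
    linarith

/-- Linear regularity: a subgradient in the range of `Aᵀ` at `X` is close, relative to the
distance of `X` to `Y`, to a subgradient in this range at `Y`. -/
theorem exists_subdiff_dist_le (hlam : 0 ≤ lam) (A : Tensor N₁ N₂ N₃) {Y W : Tensor N₂ K N₃}
    (hW : W ∈ rangeK K (ttrans A)) (hWY : W ∈ subdiff (sparseObj lam) Y) :
    ∃ C : ℝ, 0 ≤ C ∧ ∀ X, ∀ Z ∈ subdiff (sparseObj lam) X ∩ rangeK K (ttrans A),
      ∃ P ∈ rangeK K (ttrans A), P ∈ subdiff (sparseObj lam) Y ∧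
        tinner (Z - P) (Z - P) ≤ C * tinner (X - Y) (X - Y) := by
  have hWc := isEntrywiseSubgrad_of_mem_subdiff hlam hWY
  let R : Submodule ℝ (EuclideanSpace ℝ (Fin N₂ × Fin K × Fin N₃)) :=
    { carrier := {v | (fun i j k => v (i, j, k) : Tensor N₂ K N₃) ∈ rangeK K (ttrans A)}
      add_mem' := fun hv hw => add_mem_rangeK hv hw
      zero_mem' := zero_mem_rangeK _
      smul_mem' := fun c _ hv => smul_mem_rangeK c hv }
  let lo : Fin N₂ × Fin K × Fin N₃ → ℝ :=
    fun t => if Y t.1 t.2.1 t.2.2 = 0 then -lam else W t.1 t.2.1 t.2.2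
  let hi : Fin N₂ × Fin K × Fin N₃ → ℝ :=
    fun t => if Y t.1 t.2.1 t.2.2 = 0 then lam else W t.1 t.2.1 t.2.2
  let vec : Tensor N₂ K N₃ → EuclideanSpace ℝ (Fin N₂ × Fin K × Fin N₃) :=
    fun X => WithLp.toLp 2 fun t => X t.1 t.2.1 t.2.2
  have hvec : ∀ X, X ∈ rangeK K (ttrans A) → vec X ∈ R := fun X hX => hX
  obtain ⟨C, hC0, hC⟩ := exists_dist_subspace_inter_box_le R lo hi ⟨vec W, hvec W hW, fun t => by
    simp only [lo, hi, vec]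
    split_ifs with h
    · have := (hWc t.1 t.2.1 t.2.2).1
      rw [h, sub_zero] at this
      exact abs_le.1 this
    · exact ⟨le_rfl, le_rfl⟩⟩
  let c : Fin N₂ × Fin K × Fin N₃ → ℝ :=
    fun t => if Y t.1 t.2.1 t.2.2 = 0 then 1 else 1 + 2 * lam / |Y t.1 t.2.1 t.2.2|
  have hc : ∀ t, 0 ≤ c t := fun t => by
    simp only [c]
    split_ifs <;> positivity
  refine ⟨(C * ∑ t, c t) ^ 2, sq_nonneg _, fun X Z hZ => ?_⟩
  have hZc := isEntrywiseSubgrad_of_mem_subdiff hlam hZ.1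
  obtain ⟨p, hpR, hpbox, hp⟩ := hC (vec Z) (hvec Z hZ.2)
  refine ⟨fun i j k => p (i, j, k), hpR, IsEntrywiseSubgrad.mem_subdiff fun i j k => ?_, ?_⟩
  · have := hpbox (i, j, k)
    simp only [lo, hi] at this
    split_ifs at this with h
    · rw [h]
      exact ⟨by rw [sub_zero]; exact abs_le.2 this, by simp⟩
    · rw [le_antisymm this.2 this.1]
      exact hWc i j k
  · have hnorm : tinner (Z - fun i j k => p (i, j, k)) (Z - fun i j k => p (i, j, k)) =
        ‖vec Z - p‖ ^ 2 := by
      rw [EuclideanSpace.real_norm_sq_eq]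
      simp only [tinner, Fintype.sum_prod_type, sq]
      rfl
    have hviol : ∑ t, (max (vec Z t - hi t) 0 + max (lo t - vec Z t) 0) ≤
        (∑ t, c t) * frobNorm (X - Y) := by
      rw [Finset.sum_mul]
      refine Finset.sum_le_sum fun t _ => ?_
      have habs : |X t.1 t.2.1 t.2.2 - Y t.1 t.2.1 t.2.2| ≤ frobNorm (X - Y) :=
        Real.abs_le_sqrt (sq_entry_le_tinner_self (X - Y) t.1 t.2.1 t.2.2)
      refine le_trans ?_ (mul_le_mul_of_nonneg_left habs (hc t))
      simp only [vec, lo, hi, c]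
      split_ifs with h
      · rw [h, sub_zero, one_mul]
        exact violation_le_of_zero hlam (hZc _ _ _).1
      · refine le_trans (le_of_eq ?_) (violation_le_of_ne_zero h (hZc _ _ _) (hWc _ _ _))
        generalize Z t.1 t.2.1 t.2.2 = z, W t.1 t.2.1 t.2.2 = w
        rcases le_total z w with h | h
        · rw [abs_of_nonpos (by linarith), max_eq_right (by linarith), max_eq_left (by linarith)]
          ring
        · rw [abs_of_nonneg (by linarith), max_eq_left (by linarith), max_eq_right (by linarith)]
          ring
    rw [hnorm, ← frobNorm_sq (X - Y), ← mul_pow, mul_assoc]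
    exact pow_le_pow_left₀ (norm_nonneg _) (hp.trans (mul_le_mul_of_nonneg_left hviol hC0)) 2

/-- With `P` a subgradient at `Y` near `Z`, the Bregman distance is at most
`⟨Z - P, X - Y⟩ = ⟨Z - P, A† * A * (X - Y)⟩`, where `‖Z - P‖_F` is of the order of `‖X - Y‖_F`,
hence of the square root of the Bregman distance. -/
theorem exists_errorBound [NeZero N₃] (hlam : 0 ≤ lam) (A : Tensor N₁ N₂ N₃)
    {Y W : Tensor N₂ K N₃} (hW : W ∈ rangeK K (ttrans A))
    (hWY : W ∈ subdiff (sparseObj lam) Y) :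
    ∃ ν : ℝ, 0 < ν ∧ ErrorBound A (sparseObj lam) Y ν := by
  obtain ⟨C, hC0, hC⟩ := exists_subdiff_dist_le hlam A hW hWY
  set S := specNorm (tpinv A) ^ 2 with hS
  have hS0 : 0 ≤ S := sq_nonneg _
  refine ⟨1 / (2 * C * S + 1), by positivity, fun X Z hZ => ?_⟩
  obtain ⟨P, hPR, hP, hdist⟩ := hC X Z hZ
  rw [frobNorm_sq, one_div_one_div]
  set D := bregman (sparseObj lam) Z X Y
  set T := tinner (tmul A (X - Y)) (tmul A (X - Y)) with hT
  have hT0 : 0 ≤ T := tinner_self_nonneg _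
  have hD : 1 / 2 * tinner (X - Y) (X - Y) ≤ D := half_tinner_le_bregman hlam hZ.1 Y
  have hD0 : 0 ≤ D := le_trans (mul_nonneg (by norm_num) (tinner_self_nonneg _)) hD
  have h1 : D ≤ tinner (Z - P) (tmul (tpinv A) (tmul A (X - Y))) := by
    rw [← tmul_assoc, tinner_tmul_right, ttrans_tpinv_tmul, tmul_assoc,
      tpinv_tmul_of_mem_rangeK (sub_mem_rangeK hZ.2 hPR)]
    exact bregman_le_tinner hP
  have h2 : D ^ 2 ≤ (C * (2 * D)) * (S * T) :=
    calc D ^ 2 ≤ tinner (Z - P) (tmul (tpinv A) (tmul A (X - Y))) ^ 2 :=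
          pow_le_pow_left₀ hD0 h1 2
      _ ≤ _ := tinner_sq_le _ _
      _ ≤ _ := mul_le_mul (hdist.trans (mul_le_mul_of_nonneg_left (by linarith) hC0))
          (tinner_tmul_self_le _ _) (tinner_self_nonneg _) (by positivity)
  rcases hD0.eq_or_lt with h | h
  · rw [← h]
    positivity
  · have : D ≤ 2 * C * S * T := le_of_mul_le_mul_right (by linarith) h
    linarith

end ErrorBound

/-! ### One step of the algorithm -/

section Step

variable {N₁ N₂ N₃ K : ℕ} {lam αc αr : ℝ}

theorem specNorm_hslice_sq_le (A : Tensor N₁ N₂ N₃) (i : Fin N₁) :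
    specNorm (hslice A i) ^ 2 ≤ lamR A * tinner (hslice A i) (hslice A i) := by
  rcases eq_or_ne (hslice A i) 0 with h | h
  · have : specNorm (hslice A i) = 0 := by
      have h0 : bcirc (0 : Tensor 1 N₂ N₃) = 0 := rfl
      rw [specNorm, h, h0, euclLin, map_zero]
      simp
    rw [this, h]
    simp
  · rw [← div_le_iff₀ (tinner_self_pos h), ← frobNorm_sq]
    exact le_ciSup (f := fun i => specNorm (hslice A i) ^ 2 / frobNorm (hslice A i) ^ 2)
      (Set.finite_range _).bddAbove i

theorem specNorm_lslice_sq_le (A : Tensor N₁ N₂ N₃) (j : Fin N₂) :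
    specNorm (lslice A j) ^ 2 ≤ lamC A * tinner (lslice A j) (lslice A j) := by
  rcases eq_or_ne (lslice A j) 0 with h | h
  · have : specNorm (lslice A j) = 0 := by
      have h0 : bcirc (0 : Tensor N₁ 1 N₃) = 0 := rfl
      rw [specNorm, h, h0, euclLin, map_zero]
      simp
    rw [this, h]
    simp
  · rw [← div_le_iff₀ (tinner_self_pos h), ← frobNorm_sq]
    exact le_ciSup (f := fun j => specNorm (lslice A j) ^ 2 / frobNorm (lslice A j) ^ 2)
      (Set.finite_range _).bddAbove j

theorem tinner_tmul_hslice_le (A : Tensor N₁ N₂ N₃) (i : Fin N₁) (X : Tensor N₂ K N₃) :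
    tinner (tmul (hslice A i) X) (tmul (hslice A i) X) ≤
      lamR A * tinner (hslice A i) (hslice A i) * tinner X X :=
  (tinner_tmul_self_le _ _).trans
    (mul_le_mul_of_nonneg_right (specNorm_hslice_sq_le A i) (tinner_self_nonneg X))

theorem tinner_tmul_lslice_le (A : Tensor N₁ N₂ N₃) (j : Fin N₂) (X : Tensor 1 K N₃) :
    tinner (tmul (lslice A j) X) (tmul (lslice A j) X) ≤
      lamC A * tinner (lslice A j) (lslice A j) * tinner X X :=
  (tinner_tmul_self_le _ _).trans
    (mul_le_mul_of_nonneg_right (specNorm_lslice_sq_le A j) (tinner_self_nonneg X))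

theorem tinner_tmul_self_le_lamR (A : Tensor N₁ N₂ N₃) (X : Tensor N₂ K N₃) :
    tinner (tmul A X) (tmul A X) ≤ lamR A * tinner A A * tinner X X := by
  rw [← sum_tinner_hslice (tmul A X), ← sum_tinner_hslice A, Finset.mul_sum, Finset.sum_mul]
  refine Finset.sum_le_sum fun i _ => ?_
  rw [hslice_tmul]
  exact tinner_tmul_hslice_le A i X

variable [NeZero N₃]

theorem tinner_tmul_ttrans_hslice_le (A : Tensor N₁ N₂ N₃) (i : Fin N₁) (X : Tensor 1 K N₃) :
    tinner (tmul (ttrans (hslice A i)) X) (tmul (ttrans (hslice A i)) X) ≤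
      lamR A * tinner (hslice A i) (hslice A i) * tinner X X :=
  (tinner_tmul_ttrans_self_le _ _).trans
    (mul_le_mul_of_nonneg_right (specNorm_hslice_sq_le A i) (tinner_self_nonneg X))

theorem tinner_tmul_ttrans_lslice_le (A : Tensor N₁ N₂ N₃) (j : Fin N₂) (X : Tensor N₁ K N₃) :
    tinner (tmul (ttrans (lslice A j)) X) (tmul (ttrans (lslice A j)) X) ≤
      lamC A * tinner (lslice A j) (lslice A j) * tinner X X :=
  (tinner_tmul_ttrans_self_le _ _).trans
    (mul_le_mul_of_nonneg_right (specNorm_lslice_sq_le A j) (tinner_self_nonneg X))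

theorem tinner_tmul_ttrans_self_le_lamC (A : Tensor N₁ N₂ N₃) (X : Tensor N₁ K N₃) :
    tinner (tmul (ttrans A) X) (tmul (ttrans A) X) ≤ lamC A * tinner A A * tinner X X := by
  rw [← sum_tinner_hslice (tmul (ttrans A) X), ← sum_tinner_lslice A, Finset.mul_sum,
    Finset.sum_mul]
  refine Finset.sum_le_sum fun j _ => ?_
  rw [hslice_tmul, ← ttrans_lslice]
  exact tinner_tmul_ttrans_lslice_le A j X

omit [NeZero N₃] in
theorem tmul_lslice_mem_rangeK (A : Tensor N₁ N₂ N₃) (j : Fin N₂) (W : Tensor 1 K N₃) :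
    tmul (lslice A j) W ∈ rangeK K A := by
  refine ⟨fun l => if l = j then W 0 else 0, ?_⟩
  funext i c k
  simp only [tmul_apply, lslice, Finset.univ_unique, Finset.sum_singleton]
  refine Finset.sum_congr rfl fun q _ => ?_
  rw [Fintype.sum_eq_single j fun l hl => by simp [hl]]
  simp

omit [NeZero N₃] in
theorem tmul_ttrans_hslice_mem_rangeK (A : Tensor N₁ N₂ N₃) (i : Fin N₁) (W : Tensor 1 K N₃) :
    tmul (ttrans (hslice A i)) W ∈ rangeK K (ttrans A) :=
  tmul_lslice_mem_rangeK (ttrans A) i W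

/-- Averaging slice energies `t a / F a` with the pick probabilities `F a / ∑ F`. The slices of
norm zero drop out, by the convention `x / 0 = 0` and because they carry no energy. -/
theorem sum_weight_mul_div {ι : Type*} [Fintype ι] {F t : ι → ℝ} (S : ℝ)
    (h : ∀ a, F a = 0 → t a = 0) : ∑ a, F a / S * (t a / F a) = (∑ a, t a) / S := by
  rw [Finset.sum_div]
  refine Finset.sum_congr rfl fun a _ => ?_
  by_cases hF : F a = 0
  · simp [hF, h a hF]
  · field_simp

/-- The deviation of `Z` from `B - A * Xh`, the part of `B` orthogonal to the range of `A`, to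
which the iterates `Z` converge. -/
def zErr (A : Tensor N₁ N₂ N₃) (B : Tensor N₁ K N₃) (Xh : Tensor N₂ K N₃) (Z : Tensor N₁ K N₃) :
    Tensor N₁ K N₃ :=
  Z - (B - tmul A Xh)

/-- The update of `Z` annihilates `B - A * Xh`, so the deviation obeys the same recursion. -/
theorem zErr_step {A : Tensor N₁ N₂ N₃} {B : Tensor N₁ K N₃} {Xh : Tensor N₂ K N₃}
    (hXh : IsFeasible A B Xh) (j : Fin N₂) (i : Fin N₁) (s : State N₁ N₂ K N₃) :
    zErr A B Xh (step A B lam αc αr j i s).Z = zErr A B Xh s.Z -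
      (αc / tinner (lslice A j) (lslice A j)) •
        tmul (lslice A j) (tmul (ttrans (lslice A j)) (zErr A B Xh s.Z)) := by
  have h0 : tmul (ttrans (lslice A j)) (B - tmul A Xh) = 0 := by
    rw [ttrans_lslice, ← hslice_tmul, (isFeasible_iff A B Xh).1 hXh]
    rfl
  have h1 : tmul (ttrans (lslice A j)) (zErr A B Xh s.Z) = tmul (ttrans (lslice A j)) s.Z := by
    rw [zErr, tmul_sub, h0, sub_zero]
  rw [h1]
  simp only [step, zErr, tmul_smul, frobNorm_sq, smul_smul, mul_one_div]
  abel

theorem zErr_step_mem_rangeK {A : Tensor N₁ N₂ N₃} {B : Tensor N₁ K N₃} {Xh : Tensor N₂ K N₃}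
    (hXh : IsFeasible A B Xh) (j : Fin N₂) (i : Fin N₁) {s : State N₁ N₂ K N₃}
    (hs : zErr A B Xh s.Z ∈ rangeK K A) :
    zErr A B Xh (step A B lam αc αr j i s).Z ∈ rangeK K A := by
  rw [zErr_step hXh]
  exact sub_mem_rangeK hs (smul_mem_rangeK _ (tmul_lslice_mem_rangeK A j _))

omit [NeZero N₃] in
theorem step_Y_mem_rangeK {A : Tensor N₁ N₂ N₃} {B : Tensor N₁ K N₃}
    (j : Fin N₂) (i : Fin N₁) {s : State N₁ N₂ K N₃} (hs : s.Y ∈ rangeK K (ttrans A)) :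
    (step A B lam αc αr j i s).Y ∈ rangeK K (ttrans A) :=
  sub_mem_rangeK hs (smul_mem_rangeK _ (tmul_ttrans_hslice_mem_rangeK A i _))

theorem tinner_zErr_step_le {A : Tensor N₁ N₂ N₃} {B : Tensor N₁ K N₃} {Xh : Tensor N₂ K N₃}
    (hXh : IsFeasible A B Xh) (j : Fin N₂) (i : Fin N₁) (s : State N₁ N₂ K N₃) :
    tinner (zErr A B Xh (step A B lam αc αr j i s).Z)
        (zErr A B Xh (step A B lam αc αr j i s).Z) ≤
      tinner (zErr A B Xh s.Z) (zErr A B Xh s.Z) - (2 * αc - αc ^ 2 * lamC A) *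
        (tinner (tmul (ttrans (lslice A j)) (zErr A B Xh s.Z))
          (tmul (ttrans (lslice A j)) (zErr A B Xh s.Z)) / tinner (lslice A j) (lslice A j)) := by
  rw [zErr_step hXh]
  set E := zErr A B Xh s.Z
  set V := tmul (ttrans (lslice A j)) E with hV
  set F := tinner (lslice A j) (lslice A j)
  have h1 : tinner E (tmul (lslice A j) V) = tinner V V := by
    rw [tinner_tmul_right]
  have h2 := tinner_tmul_lslice_le A j V
  rcases (tinner_self_nonneg (lslice A j)).eq_or_lt with h | h
  · simp [F, ← h]
  · have h3 : (αc / F) ^ 2 * tinner (tmul (lslice A j) V) (tmul (lslice A j) V) ≤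
        (αc / F) ^ 2 * (lamC A * F * tinner V V) :=
      mul_le_mul_of_nonneg_left h2 (sq_nonneg _)
    have e : (αc / F) ^ 2 * (lamC A * F * tinner V V) = αc ^ 2 * lamC A * (tinner V V / F) := by
      have : F ≠ 0 := h.ne'
      field_simp
    simp only [tinner_sub_left, tinner_sub_right, tinner_smul_left, tinner_smul_right, h1,
      tinner_comm _ E]
    have e2 : αc / F * tinner V V = αc * (tinner V V / F) := by ring
    rw [e] at h3
    rw [e2]
    linarith

/-- The average of the squared deviation of `Z` contracts by the factor `rhoC`. -/
theorem sum_tinner_zErr_step_le {A : Tensor N₁ N₂ N₃} (hA : A ≠ 0) {B : Tensor N₁ K N₃}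
    {Xh : Tensor N₂ K N₃} (hXh : IsFeasible A B Xh) (hαc : 0 ≤ 2 * αc - αc ^ 2 * lamC A)
    (i : Fin N₁) {s : State N₁ N₂ K N₃} (hs : zErr A B Xh s.Z ∈ rangeK K A) :
    ∑ j, tinner (lslice A j) (lslice A j) / tinner A A *
        tinner (zErr A B Xh (step A B lam αc αr j i s).Z)
          (zErr A B Xh (step A B lam αc αr j i s).Z) ≤
      rhoC A αc * tinner (zErr A B Xh s.Z) (zErr A B Xh s.Z) := by
  have hF : 0 < tinner A A := tinner_self_pos hA
  set E := zErr A B Xh s.Z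
  have hsig : sigmaMin (bcirc A) ^ 2 * tinner E E ≤
      tinner (tmul (ttrans A) E) (tmul (ttrans A) E) := by
    obtain ⟨V, hV⟩ := hs
    dsimp only at hV
    rw [← hV]
    exact sigmaMin_sq_mul_tinner_le A V
  have hw : ∑ j, tinner (lslice A j) (lslice A j) / tinner A A = 1 := by
    rw [← Finset.sum_div, sum_tinner_lslice, div_self hF.ne']
  have ht := sum_weight_mul_div (tinner A A)
    (F := fun j => tinner (lslice A j) (lslice A j))
    (t := fun j => tinner (tmul (ttrans (lslice A j)) E) (tmul (ttrans (lslice A j)) E))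
    fun j hj => le_antisymm
      (by simpa [hj] using tinner_tmul_ttrans_lslice_le A j E) (tinner_self_nonneg _)
  have hsum : ∑ j, tinner (tmul (ttrans (lslice A j)) E) (tmul (ttrans (lslice A j)) E) =
      tinner (tmul (ttrans A) E) (tmul (ttrans A) E) := by
    rw [← sum_tinner_hslice (tmul (ttrans A) E)]
    simp only [hslice_tmul, ttrans_lslice]
  rw [hsum] at ht
  calc _ ≤ ∑ j, tinner (lslice A j) (lslice A j) / tinner A A *
          (tinner E E - (2 * αc - αc ^ 2 * lamC A) *
            (tinner (tmul (ttrans (lslice A j)) E) (tmul (ttrans (lslice A j)) E) /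
              tinner (lslice A j) (lslice A j))) :=
        Finset.sum_le_sum fun j _ => mul_le_mul_of_nonneg_left (tinner_zErr_step_le hXh j i s)
          (div_nonneg (tinner_self_nonneg _) hF.le)
    _ = tinner E E - (2 * αc - αc ^ 2 * lamC A) *
          (tinner (tmul (ttrans A) E) (tmul (ttrans A) E) / tinner A A) := by
        simp only [mul_sub, Finset.sum_sub_distrib]
        rw [← Finset.sum_mul, hw, one_mul, ← ht, Finset.mul_sum]
        congr 1
        exact Finset.sum_congr rfl fun j _ => by ring
    _ ≤ tinner E E - (2 * αc - αc ^ 2 * lamC A) *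
          (sigmaMin (bcirc A) ^ 2 * tinner E E / tinner A A) := by
        gcongr
    _ = rhoC A αc * tinner E E := by
        rw [rhoC, frobNorm_sq]
        ring

omit [NeZero N₃] in
/-- Moving the subgradient changes the Bregman distance to a fixed point at most like the
linearization plus half the squared step, because the conjugate of `f` is 1-smooth. -/
theorem bregman_le_add (hlam : 0 ≤ lam) {X X' Y Y' : Tensor N₁ N₂ N₃}
    (hY : Y ∈ subdiff (sparseObj lam) X) (W : Tensor N₁ N₂ N₃) :
    bregman (sparseObj lam) Y' X' W ≤ bregman (sparseObj lam) Y X W +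
      tinner (Y' - Y) (X - W) + 1 / 2 * tinner (Y' - Y) (Y' - Y) := by
  have h1 := (isEntrywiseSubgrad_of_mem_subdiff hlam hY).sparseObj_le X'
  have h2 := tinner_self_nonneg ((Y' - Y) - (X' - X))
  rw [tinner_sub_left (Y' - Y) (X' - X), tinner_sub_right (Y' - Y) (Y' - Y) (X' - X),
    tinner_sub_right (X' - X) (Y' - Y) (X' - X), tinner_comm (X' - X) (Y' - Y)] at h2
  have e : tinner Y (W - X) - tinner Y' (W - X') - tinner (Y' - Y) (X - W) =
      tinner (Y' - Y) (X' - X) + tinner Y (X' - X) := by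
    simp only [tinner_sub_left, tinner_sub_right]
    ring
  rw [bregman, bregman]
  linarith

/-- The Bregman distance after a step: the step is compared with the one for consistent data,
and the effect of the deviation of `Z` is split off by Young's inequality. -/
theorem bregman_step_le (hlam : 0 ≤ lam) {A : Tensor N₁ N₂ N₃} {B : Tensor N₁ K N₃}
    {Xh : Tensor N₂ K N₃} {δ : ℝ} (hδ : 0 < δ) (j : Fin N₂) (i : Fin N₁)
    {s : State N₁ N₂ K N₃} (hs : s.Y ∈ subdiff (sparseObj lam) s.X) :
    bregman (sparseObj lam) (step A B lam αc αr j i s).Y (step A B lam αc αr j i s).X Xh ≤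
      (1 + δ) * (bregman (sparseObj lam) s.Y s.X Xh - (αr - αr ^ 2 * lamR A / 2) *
        (tinner (tmul (hslice A i) (s.X - Xh)) (tmul (hslice A i) (s.X - Xh)) /
          tinner (hslice A i) (hslice A i))) +
      (δ + 1) / (2 * δ) * (αr ^ 2 * lamR A) *
        (tinner (hslice (zErr A B Xh (step A B lam αc αr j i s).Z) i)
          (hslice (zErr A B Xh (step A B lam αc αr j i s).Z) i) /
            tinner (hslice A i) (hslice A i)) := by
  set s' := step A B lam αc αr j i s with hs'
  set F := tinner (hslice A i) (hslice A i) with hF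
  set e := hslice (zErr A B Xh s'.Z) i with he
  set u := tmul (hslice A i) (s.X - Xh) with hu
  have hY' : s'.Y = s.Y - (αr / F) • tmul (ttrans (hslice A i)) u -
      (αr / F) • tmul (ttrans (hslice A i)) e := by
    have h1 : tmul (hslice A i) s.X - hslice B i + hslice s'.Z i = u + e := by
      have : e = hslice s'.Z i - (hslice B i - tmul (hslice A i) Xh) := by
        rw [← hslice_tmul]; rfl
      rw [this, hu, tmul_sub]
      abel
    have h2 : s'.Y = s.Y - αr • tmul (ttrans (hslice A i))
        ((1 / frobNorm (hslice A i) ^ 2) •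
          (tmul (hslice A i) s.X - hslice B i + hslice s'.Z i)) := rfl
    rw [h2, h1, tmul_smul, smul_smul, frobNorm_sq, mul_one_div, tmul_add, smul_add, sub_sub]
  set Yt := s.Y - (αr / F) • tmul (ttrans (hslice A i)) u with hYt
  set Xt := softShrink lam Yt with hXt
  have hmem : Yt ∈ subdiff (sparseObj lam) Xt := mem_subdiff_softShrink hlam Yt
  have hquad : ∀ w : Tensor 1 K N₃,
      tinner ((αr / F) • tmul (ttrans (hslice A i)) w) ((αr / F) • tmul (ttrans (hslice A i)) w) ≤
        αr ^ 2 * lamR A * (tinner w w / F) := by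
    intro w
    rw [tinner_smul_left, tinner_smul_right]
    rcases (tinner_self_nonneg (hslice A i)).eq_or_lt with h | h
    · rw [hF, ← h]; simp
    · have h0 : F ≠ 0 := h.ne'
      have := mul_le_mul_of_nonneg_left (tinner_tmul_ttrans_hslice_le A i w) (sq_nonneg (αr / F))
      have e1 : (αr / F) ^ 2 * (lamR A * F * tinner w w) =
          αr ^ 2 * lamR A * (tinner w w / F) := by
        field_simp
      rw [e1] at this
      linarith
  have h1 : bregman (sparseObj lam) Yt Xt Xh ≤ bregman (sparseObj lam) s.Y s.X Xh -
      (αr - αr ^ 2 * lamR A / 2) * (tinner u u / F) := by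
    have hstep := bregman_le_add hlam hs (X' := Xt) (Y' := Yt) Xh
    have e1 : Yt - s.Y = -((αr / F) • tmul (ttrans (hslice A i)) u) := by rw [hYt]; abel
    rw [e1] at hstep
    have e2 : tinner (-((αr / F) • tmul (ttrans (hslice A i)) u)) (s.X - Xh) =
        -(αr * (tinner u u / F)) := by
      rw [tinner_neg_left, tinner_smul_left, tinner_tmul_ttrans_left, ← hu]
      ring
    rw [e2, tinner_neg_left, tinner_neg_right, neg_neg] at hstep
    have := hquad u
    linarith
  have h2 : bregman (sparseObj lam) s'.Y s'.X Xh ≤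
      (1 + δ) * bregman (sparseObj lam) Yt Xt Xh +
        (δ + 1) / (2 * δ) * (αr ^ 2 * lamR A * (tinner e e / F)) := by
    have hstep := bregman_le_add hlam hmem (X' := s'.X) (Y' := s'.Y) Xh
    have e1 : s'.Y - Yt = -((αr / F) • tmul (ttrans (hslice A i)) e) := by rw [hY']; abel
    have hy := tinner_le_young hδ (s'.Y - Yt) (Xt - Xh)
    have hsc := mul_le_mul_of_nonneg_left (half_tinner_le_bregman hlam hmem Xh) hδ.le
    have hq : tinner (s'.Y - Yt) (s'.Y - Yt) ≤ αr ^ 2 * lamR A * (tinner e e / F) := by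
      rw [e1, tinner_neg_left, tinner_neg_right, neg_neg]
      exact hquad e
    have hq2 := mul_le_mul_of_nonneg_left hq (show 0 ≤ (δ + 1) / (2 * δ) by positivity)
    have e3 : (δ + 1) / (2 * δ) * tinner (s'.Y - Yt) (s'.Y - Yt) =
        1 / (2 * δ) * tinner (s'.Y - Yt) (s'.Y - Yt) +
          1 / 2 * tinner (s'.Y - Yt) (s'.Y - Yt) := by
      field_simp
      ring
    linarith
  have h3 := mul_le_mul_of_nonneg_left h1 (show 0 ≤ 1 + δ by positivity)
  linarith

/-- The average over the horizontal slice of the Bregman distance after a step. -/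
theorem sum_bregman_step_le (hlam : 0 ≤ lam) {A : Tensor N₁ N₂ N₃} (hA : A ≠ 0)
    {B : Tensor N₁ K N₃} {Xh : Tensor N₂ K N₃} {ν : ℝ} (hν : 0 < ν)
    (hEB : ErrorBound A (sparseObj lam) Xh ν) (hαr : 0 ≤ 2 * αr - αr ^ 2 * lamR A)
    {δ : ℝ} (hδ : 0 < δ) (j : Fin N₂) (i₀ : Fin N₁) {s : State N₁ N₂ K N₃}
    (hs : s.Y ∈ subdiff (sparseObj lam) s.X) (hsR : s.Y ∈ rangeK K (ttrans A)) :
    ∑ i, tinner (hslice A i) (hslice A i) / tinner A A *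
        bregman (sparseObj lam) (step A B lam αc αr j i s).Y (step A B lam αc αr j i s).X Xh ≤
      (1 + δ) * rhoR A αr ν * bregman (sparseObj lam) s.Y s.X Xh +
        (δ + 1) / (2 * δ) * (αr ^ 2 * lamR A / tinner A A) *
          tinner (zErr A B Xh (step A B lam αc αr j i₀ s).Z)
            (zErr A B Xh (step A B lam αc αr j i₀ s).Z) := by
  have hF : 0 < tinner A A := tinner_self_pos hA
  set D := bregman (sparseObj lam) s.Y s.X Xh with hD
  set E := zErr A B Xh (step A B lam αc αr j i₀ s).Z with hE
  set T := tinner (tmul A (s.X - Xh)) (tmul A (s.X - Xh)) with hT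
  have hbound : ν * D ≤ T := by
    have := hEB s.X s.Y ⟨hs, hsR⟩
    rw [frobNorm_sq, one_div, inv_mul_eq_div, le_div_iff₀ hν] at this
    linarith
  have hlamR : 0 ≤ lamR A := Real.iSup_nonneg fun i => by positivity
  have hw : ∑ i, tinner (hslice A i) (hslice A i) / tinner A A = 1 := by
    rw [← Finset.sum_div, sum_tinner_hslice, div_self hF.ne']
  have ht := sum_weight_mul_div (tinner A A)
    (F := fun i => tinner (hslice A i) (hslice A i))
    (t := fun i => tinner (tmul (hslice A i) (s.X - Xh)) (tmul (hslice A i) (s.X - Xh)))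
    fun i hi => le_antisymm
      (by simpa [hi] using tinner_tmul_hslice_le A i (s.X - Xh)) (tinner_self_nonneg _)
  have hsum : ∑ i, tinner (tmul (hslice A i) (s.X - Xh)) (tmul (hslice A i) (s.X - Xh)) = T := by
    rw [hT, ← sum_tinner_hslice (tmul A (s.X - Xh))]
    simp only [hslice_tmul]
  rw [hsum] at ht
  have ht' : ∑ i, tinner (hslice A i) (hslice A i) / tinner A A *
      (tinner (hslice E i) (hslice E i) / tinner (hslice A i) (hslice A i)) ≤
        tinner E E / tinner A A := by
    rw [← sum_tinner_hslice E, Finset.sum_div]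
    refine Finset.sum_le_sum fun i _ => ?_
    rcases (tinner_self_nonneg (hslice A i)).eq_or_lt with h | h
    · rw [← h]
      simpa using div_nonneg (tinner_self_nonneg _) hF.le
    · refine le_of_eq ?_
      have := h.ne'
      field_simp
  calc _ ≤ ∑ i, tinner (hslice A i) (hslice A i) / tinner A A *
          ((1 + δ) * (D - (αr - αr ^ 2 * lamR A / 2) *
            (tinner (tmul (hslice A i) (s.X - Xh)) (tmul (hslice A i) (s.X - Xh)) /
              tinner (hslice A i) (hslice A i))) +
          (δ + 1) / (2 * δ) * (αr ^ 2 * lamR A) *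
            (tinner (hslice E i) (hslice E i) / tinner (hslice A i) (hslice A i))) :=
        Finset.sum_le_sum fun i _ => mul_le_mul_of_nonneg_left
          (bregman_step_le hlam hδ j i hs) (div_nonneg (tinner_self_nonneg _) hF.le)
    _ = (1 + δ) * (D - (αr - αr ^ 2 * lamR A / 2) * (T / tinner A A)) +
          (δ + 1) / (2 * δ) * (αr ^ 2 * lamR A) *
            ∑ i, tinner (hslice A i) (hslice A i) / tinner A A *
              (tinner (hslice E i) (hslice E i) / tinner (hslice A i) (hslice A i)) := by
        rw [← ht, show D = ∑ i, tinner (hslice A i) (hslice A i) / tinner A A * D by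
          rw [← Finset.sum_mul, hw, one_mul]]
        simp only [Finset.mul_sum, ← Finset.sum_sub_distrib, ← Finset.sum_add_distrib]
        refine Finset.sum_congr rfl fun i _ => ?_
        simp only [← Finset.sum_mul, hw]
        ring
    _ ≤ (1 + δ) * (D - (αr - αr ^ 2 * lamR A / 2) * (ν * D / tinner A A)) +
          (δ + 1) / (2 * δ) * (αr ^ 2 * lamR A) * (tinner E E / tinner A A) := by
        have h0 : 0 ≤ αr - αr ^ 2 * lamR A / 2 := by linarith
        gcongr
    _ = _ := by
        rw [rhoR, frobNorm_sq]
        field_simp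

end Step

/-! ### Expectations along a recursion driven by independent picks -/

section Probability

variable {Ω : Type*} [MeasurableSpace Ω] {μ : Measure Ω} [IsProbabilityMeasure μ]
  {α S : Type*} [Finite α] [MeasurableSpace α] [MeasurableSingletonClass α]

omit [MeasurableSpace Ω] [Finite α] [MeasurableSpace α] [MeasurableSingletonClass α] in
theorem exists_eq_history {u : ℕ → Ω → α} {stp : α → S → S} {s₀ : S} {s : ℕ → Ω → S}
    (h0 : ∀ ω, s 0 ω = s₀) (hs : ∀ k ω, s (k + 1) ω = stp (u k ω) (s k ω)) (k : ℕ) :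
    ∃ F : ((Finset.range k) → α) → S, ∀ ω, s k ω = F fun t => u t ω := by
  induction k with
  | zero => exact ⟨fun _ => s₀, h0⟩
  | succ k ih =>
    obtain ⟨F, hF⟩ := ih
    refine ⟨fun h => stp (h ⟨k, Finset.self_mem_range_succ k⟩)
      (F fun t => h ⟨t, Finset.mem_range.2 ((Finset.mem_range.1 t.2).trans (Nat.lt_succ_self k))⟩),
      fun ω => ?_⟩
    rw [hs, hF]

theorem integrable_of_history {u : ℕ → Ω → α} (hu : ∀ k, Measurable (u k)) {stp : α → S → S}
    {s₀ : S} {s : ℕ → Ω → S} (h0 : ∀ ω, s 0 ω = s₀)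
    (hs : ∀ k ω, s (k + 1) ω = stp (u k ω) (s k ω)) (g : S → ℝ) (k : ℕ) :
    Integrable (fun ω => g (s k ω)) μ := by
  obtain ⟨F, hF⟩ := exists_eq_history h0 hs k
  have hm : Measurable fun ω => (fun t : Finset.range k => u t ω) :=
    measurable_pi_lambda _ fun t => hu t
  have : IsProbabilityMeasure (μ.map fun ω => (fun t : Finset.range k => u t ω)) :=
    Measure.isProbabilityMeasure_map hm.aemeasurable
  have hint : Integrable (g ∘ F) (μ.map fun ω => (fun t : Finset.range k => u t ω)) :=
    Integrable.of_finite
  simp only [hF]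
  exact hint.comp_measurable hm

/-- The expectation after one more step: the next pick is independent of the current state, so it
may be averaged out first. -/
theorem integral_step_eq [Fintype α] {u : ℕ → Ω → α} (hu : ∀ k, Measurable (u k))
    (hind : iIndepFun u μ)
    {stp : α → S → S} {s₀ : S} {s : ℕ → Ω → S} (h0 : ∀ ω, s 0 ω = s₀)
    (hs : ∀ k ω, s (k + 1) ω = stp (u k ω) (s k ω)) (g : S → ℝ) (k : ℕ) :
    ∫ ω, g (s (k + 1) ω) ∂μ =
      ∫ ω, ∑ a, μ.real {ω | u k ω = a} * g (stp a (s k ω)) ∂μ := by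
  classical
  obtain ⟨F, hF⟩ := exists_eq_history h0 hs k
  have hm : Measurable fun ω => (fun t : Finset.range k => u t ω) :=
    measurable_pi_lambda _ fun t => hu t
  have hindep : IndepFun (u k) (fun ω => (fun t : Finset.range k => u t ω)) μ :=
    (hind.indepFun_finset {k} (Finset.range k) (by simp) hu).comp
      (φ := fun h : ({k} : Finset ℕ) → α => h ⟨k, Finset.mem_singleton_self k⟩) (ψ := id)
      (measurable_pi_apply _) measurable_id
  have hsplit : ∀ ω, g (s (k + 1) ω) =
      ∑ a, (if u k ω = a then (1 : ℝ) else 0) * g (stp a (s k ω)) := fun ω => by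
    simp [hs]
  have hI : ∀ a, Integrable (fun ω => g (stp a (s k ω))) μ := fun a =>
    integrable_of_history hu h0 hs (fun x => g (stp a x)) k
  have hmeas : ∀ a, MeasurableSet {ω | u k ω = a} := fun a =>
    hu k (measurableSet_singleton a)
  have hind1 : ∀ a ω, (if u k ω = a then (1 : ℝ) else 0) * g (stp a (s k ω)) =
      Set.indicator {ω | u k ω = a} (fun ω => g (stp a (s k ω))) ω := fun a ω => by
    simp [Set.indicator_apply]
  simp only [hsplit]
  rw [integral_finsetSum _ fun a _ => by
      simp only [hind1]; exact (hI a).indicator (hmeas a),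
    integral_finsetSum _ fun a _ => (hI a).const_mul _]
  refine Finset.sum_congr rfl fun a _ => ?_
  have hprod := hindep.integral_fun_comp_mul_comp (f := fun b => if b = a then (1 : ℝ) else 0)
    (g := fun h => g (stp a (F h))) (hu k).aemeasurable hm.aemeasurable
    (Measurable.of_discrete).aestronglyMeasurable (Measurable.of_discrete).aestronglyMeasurable
  simp only [← hF] at hprod
  rw [hprod, integral_const_mul]
  congr 1
  have : (fun ω => if u k ω = a then (1 : ℝ) else 0) =
      Set.indicator {ω | u k ω = a} fun _ => (1 : ℝ) := by
    funext ω; simp [Set.indicator_apply]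
  rw [this, integral_indicator_const _ (hmeas a), smul_eq_mul, mul_one]

end Probability

/-! ### The rates and the convergence estimates -/

section Rates

variable {N₁ N₂ N₃ K : ℕ} {lam αc αr : ℝ}

theorem step_size_pos {α l : ℝ} (hα : 0 < α) (h : α < 2 / l) : 0 < 2 * α - α ^ 2 * l := by
  have hl : 0 < l := (div_pos_iff_of_pos_left two_pos).1 (hα.trans h)
  rw [lt_div_iff₀ hl] at h
  have : 2 * α - α ^ 2 * l = α * (2 - α * l) := by ring
  rw [this]
  exact mul_pos hα (by linarith)

theorem rate_nonneg {α l F t : ℝ} (hF : 0 < F) (hα : 0 ≤ 2 * α - α ^ 2 * l) (ht : t ≤ l * F) :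
    0 ≤ 1 - (2 * α - α ^ 2 * l) * t / F := by
  rw [sub_nonneg, div_le_one hF]
  have h1 := mul_le_mul_of_nonneg_left ht hα
  have h2 : 0 ≤ (α * l - 1) ^ 2 * F := by positivity
  nlinarith

theorem rhoC_lt_one {A : Tensor N₁ N₂ N₃} (hA : A ≠ 0) [NeZero N₃]
    (hαc : 0 < 2 * αc - αc ^ 2 * lamC A) : rhoC A αc < 1 := by
  have hb : bcirc A ≠ 0 := fun h => hA (bcirc_injective (h.trans rfl))
  have hF := tinner_self_pos hA
  have hσ := sigmaMin_pos hb
  rw [rhoC, frobNorm_sq, sub_lt_self_iff]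
  positivity

theorem rhoC_nonneg {A : Tensor N₁ N₂ N₃} (hA : A ≠ 0) [NeZero N₃]
    (hαc : 0 ≤ 2 * αc - αc ^ 2 * lamC A) : 0 ≤ rhoC A αc := by
  obtain ⟨X, hX⟩ := exists_tmul_ne_zero hA
  have h := (sigmaMin_sq_mul_tinner_le A X).trans (tinner_tmul_ttrans_self_le_lamC A (tmul A X))
  rw [rhoC, frobNorm_sq]
  exact rate_nonneg (tinner_self_pos hA) hαc (le_of_mul_le_mul_right h (tinner_self_pos hX))

theorem rhoR_lt_one {A : Tensor N₁ N₂ N₃} (hA : A ≠ 0) {ν : ℝ} (hν : 0 < ν)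
    (hαr : 0 < 2 * αr - αr ^ 2 * lamR A) : rhoR A αr ν < 1 := by
  have hF := tinner_self_pos hA
  rw [rhoR, frobNorm_sq, sub_lt_self_iff]
  positivity

/-- The error bound at one point other than `Xh` limits `ν` by `2 * lamR A * ‖A‖_F²`. -/
theorem rhoR_nonneg {A : Tensor N₁ N₂ N₃} (hA : A ≠ 0) (hlam : 0 ≤ lam) {ν : ℝ} (hν : 0 < ν)
    (hαr : 0 ≤ 2 * αr - αr ^ 2 * lamR A) {Xh Z : Tensor N₂ K N₃}
    (hEB : ErrorBound A (sparseObj lam) Xh ν) (hZ : Z ∈ rangeK K (ttrans A))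
    (hne : softShrink lam Z ≠ Xh) : 0 ≤ rhoR A αr ν := by
  have hmem := mem_subdiff_softShrink hlam Z
  set X := softShrink lam Z
  have h1 := hEB X Z ⟨hmem, hZ⟩
  have h2 := half_tinner_le_bregman hlam hmem Xh
  have h3 := tinner_tmul_self_le_lamR A (X - Xh)
  have hpos : 0 < tinner (X - Xh) (X - Xh) := tinner_self_pos (sub_ne_zero.2 hne)
  rw [frobNorm_sq, one_div, inv_mul_eq_div, le_div_iff₀ hν] at h1
  have h4 : ν / 2 ≤ lamR A * tinner A A := by
    refine le_of_mul_le_mul_right ?_ hpos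
    have := mul_le_mul_of_nonneg_right h2 hν.le
    linarith
  have := rate_nonneg (tinner_self_pos hA) hαr h4
  rw [rhoR, frobNorm_sq]
  convert this using 2
  have := (tinner_self_pos hA).ne'
  field_simp

theorem le_of_linear_recursion {d e : ℕ → ℝ} {q r c : ℝ} (hq : 0 ≤ q) (hc : 0 ≤ c) (hr : 0 ≤ r)
    (he : ∀ k, e (k + 1) ≤ r * e k) (hd : ∀ k, d (k + 1) ≤ q * d k + c * e (k + 1)) (k : ℕ) :
    d k ≤ c * e 0 * ∑ l ∈ Finset.range k, r ^ (k - l) * q ^ l + q ^ k * d 0 := by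
  have hek : ∀ k, e k ≤ r ^ k * e 0 := fun k => by
    induction k with
    | zero => simp
    | succ k ih =>
      calc e (k + 1) ≤ r * e k := he k
        _ ≤ r * (r ^ k * e 0) := mul_le_mul_of_nonneg_left ih hr
        _ = _ := by ring
  induction k with
  | zero => simp
  | succ k ih =>
    have hsum : ∑ l ∈ Finset.range (k + 1), r ^ (k + 1 - l) * q ^ l =
        q * ∑ l ∈ Finset.range k, r ^ (k - l) * q ^ l + r ^ (k + 1) := by
      rw [Finset.sum_range_succ', Finset.mul_sum]
      congr 1
      · refine Finset.sum_congr rfl fun l _ => ?_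
        rw [Nat.add_sub_add_right]
        ring
      · simp
    calc d (k + 1) ≤ q * d k + c * e (k + 1) := hd k
      _ ≤ q * (c * e 0 * ∑ l ∈ Finset.range k, r ^ (k - l) * q ^ l + q ^ k * d 0) +
          c * (r ^ (k + 1) * e 0) :=
        add_le_add (mul_le_mul_of_nonneg_left ih hq) (mul_le_mul_of_nonneg_left (hek _) hc)
      _ = _ := by rw [hsum]; ring

/-- Bounding both rates by their maximum turns the convolution into a geometric sum. -/
theorem sum_rates_le {r q δ : ℝ} (hr : 0 ≤ r) (hq : 0 ≤ q) (hδ : 0 < δ) (k : ℕ) :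
    ∑ l ∈ Finset.range k, r ^ (k - l) * (1 + δ) ^ l * q ^ l ≤
      (1 + δ) ^ k * max r q ^ k * (1 / δ) := by
  have hm : 0 ≤ max r q := hr.trans (le_max_left _ _)
  calc _ ≤ ∑ l ∈ Finset.range k, max r q ^ k * (1 + δ) ^ l := by
        refine Finset.sum_le_sum fun l hl => ?_
        have e : max r q ^ k * (1 + δ) ^ l = max r q ^ (k - l) * (1 + δ) ^ l * max r q ^ l := by
          rw [← Nat.sub_add_cancel (Finset.mem_range.1 hl).le, pow_add, Nat.add_sub_cancel]
          ring
        rw [e]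
        gcongr
        · exact le_max_left _ _
        · exact le_max_right _ _
    _ = max r q ^ k * (((1 + δ) ^ k - 1) / δ) := by
        rw [← Finset.mul_sum, geom_sum_eq (by linarith), add_sub_cancel_left]
    _ ≤ max r q ^ k * ((1 + δ) ^ k / δ) := by
        gcongr
        linarith
    _ = _ := by ring

end Rates

/-! ### Expected decrease along the iterates -/

section Expectation

variable {N₁ N₂ N₃ K : ℕ} {lam αc αr : ℝ}

theorem run_X_eq (A : Tensor N₁ N₂ N₃) (B : Tensor N₁ K N₃) (Y₀ : Tensor N₂ K N₃) {Ω : Type*}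
    (j : ℕ → Ω → Fin N₂) (i : ℕ → Ω → Fin N₁) (k : ℕ) (ω : Ω) :
    (run A B lam αc αr Y₀ j i k ω).X = softShrink lam (run A B lam αc αr Y₀ j i k ω).Y := by
  cases k <;> rfl

theorem run_Y_mem_subdiff (hlam : 0 ≤ lam) (A : Tensor N₁ N₂ N₃) (B : Tensor N₁ K N₃)
    (Y₀ : Tensor N₂ K N₃) {Ω : Type*} (j : ℕ → Ω → Fin N₂) (i : ℕ → Ω → Fin N₁) (k : ℕ) (ω : Ω) :
    (run A B lam αc αr Y₀ j i k ω).Y ∈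
      subdiff (sparseObj lam) (run A B lam αc αr Y₀ j i k ω).X := by
  rw [run_X_eq]
  exact mem_subdiff_softShrink hlam _

theorem run_Y_mem_rangeK {A : Tensor N₁ N₂ N₃} {B : Tensor N₁ K N₃} {Y₀ : Tensor N₂ K N₃}
    (hY₀ : Y₀ ∈ rangeK K (ttrans A)) {Ω : Type*} (j : ℕ → Ω → Fin N₂) (i : ℕ → Ω → Fin N₁)
    (k : ℕ) (ω : Ω) : (run A B lam αc αr Y₀ j i k ω).Y ∈ rangeK K (ttrans A) := by
  induction k with
  | zero => exact hY₀
  | succ k ih => exact step_Y_mem_rangeK _ _ ih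

theorem zErr_run_zero (A : Tensor N₁ N₂ N₃) (B : Tensor N₁ K N₃) (Xh Y₀ : Tensor N₂ K N₃)
    {Ω : Type*} (j : ℕ → Ω → Fin N₂) (i : ℕ → Ω → Fin N₁) (ω : Ω) :
    zErr A B Xh (run A B lam αc αr Y₀ j i 0 ω).Z = tmul A Xh :=
  sub_sub_cancel _ _

theorem zErr_run_mem_rangeK [NeZero N₃] {A : Tensor N₁ N₂ N₃} {B : Tensor N₁ K N₃}
    {Xh : Tensor N₂ K N₃} (hXh : IsFeasible A B Xh) (Y₀ : Tensor N₂ K N₃) {Ω : Type*}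
    (j : ℕ → Ω → Fin N₂) (i : ℕ → Ω → Fin N₁) (k : ℕ) (ω : Ω) :
    zErr A B Xh (run A B lam αc αr Y₀ j i k ω).Z ∈ rangeK K A := by
  induction k with
  | zero => rw [zErr_run_zero]; exact ⟨Xh, rfl⟩
  | succ k ih => exact zErr_step_mem_rangeK hXh _ _ ih

variable {Ω : Type*} [MeasurableSpace Ω] {μ : Measure Ω}
  {j : ℕ → Ω → Fin N₂} {i : ℕ → Ω → Fin N₁}

theorem IsPicks.measureReal_pair {A : Tensor N₁ N₂ N₃} (h : IsPicks A μ j i) (k : ℕ)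
    (a : Fin N₂ × Fin N₁) :
    μ.real {ω | (j k ω, i k ω) = a} = tinner (lslice A a.1) (lslice A a.1) / tinner A A *
      (tinner (hslice A a.2) (hslice A a.2) / tinner A A) := by
  have h1 := (h.indep_within k).measure_inter_preimage_eq_mul {a.1} {a.2}
    (measurableSet_singleton _) (measurableSet_singleton _)
  have h2 : {ω | (j k ω, i k ω) = a} = j k ⁻¹' {a.1} ∩ i k ⁻¹' {a.2} := by
    ext ω
    simp [Prod.ext_iff]
  simp only [← frobNorm_sq]
  rw [h2, Measure.real, h1, ENNReal.toReal_mul, ← h.prob_j k a.1, ← h.prob_i k a.2]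
  rfl

variable [IsProbabilityMeasure μ]

theorem IsPicks.integrable_run {A : Tensor N₁ N₂ N₃} (h : IsPicks A μ j i) (B : Tensor N₁ K N₃)
    (Y₀ : Tensor N₂ K N₃) (g : State N₁ N₂ K N₃ → ℝ) (k : ℕ) :
    Integrable (fun ω => g (run A B lam αc αr Y₀ j i k ω)) μ :=
  integrable_of_history (u := fun k ω => (j k ω, i k ω))
    (stp := fun a s => step A B lam αc αr a.1 a.2 s)
    (fun k => (h.measurable_j k).prodMk (h.measurable_i k)) (fun _ => rfl) (fun _ _ => rfl) g k

theorem IsPicks.integral_run_succ {A : Tensor N₁ N₂ N₃} (h : IsPicks A μ j i)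
    (B : Tensor N₁ K N₃) (Y₀ : Tensor N₂ K N₃) (g : State N₁ N₂ K N₃ → ℝ) (k : ℕ) :
    ∫ ω, g (run A B lam αc αr Y₀ j i (k + 1) ω) ∂μ =
      ∫ ω, ∑ a, tinner (lslice A a) (lslice A a) / tinner A A *
        ∑ b, tinner (hslice A b) (hslice A b) / tinner A A *
          g (step A B lam αc αr a b (run A B lam αc αr Y₀ j i k ω)) ∂μ := by
  rw [integral_step_eq (u := fun k ω => (j k ω, i k ω))
    (stp := fun a s => step A B lam αc αr a.1 a.2 s)
    (fun k => (h.measurable_j k).prodMk (h.measurable_i k)) h.indep_steps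
    (s := run A B lam αc αr Y₀ j i) (fun _ => rfl) (fun _ _ => rfl) g k]
  simp only [h.measureReal_pair, Fintype.sum_prod_type, Finset.mul_sum, mul_assoc]

/-- The deviation of `Z` after a step does not depend on the horizontal slice `b`. -/
theorem IsPicks.integral_zErr_run_succ {A : Tensor N₁ N₂ N₃} (hA : A ≠ 0) (h : IsPicks A μ j i)
    (B : Tensor N₁ K N₃) (Xh Y₀ : Tensor N₂ K N₃) (b₀ : Fin N₁) (k : ℕ) :
    ∫ ω, tinner (zErr A B Xh (run A B lam αc αr Y₀ j i (k + 1) ω).Z)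
        (zErr A B Xh (run A B lam αc αr Y₀ j i (k + 1) ω).Z) ∂μ =
      ∫ ω, ∑ a, tinner (lslice A a) (lslice A a) / tinner A A *
        tinner (zErr A B Xh (step A B lam αc αr a b₀ (run A B lam αc αr Y₀ j i k ω)).Z)
          (zErr A B Xh (step A B lam αc αr a b₀ (run A B lam αc αr Y₀ j i k ω)).Z) ∂μ := by
  rw [h.integral_run_succ B Y₀ (fun s => tinner (zErr A B Xh s.Z) (zErr A B Xh s.Z)) k]
  have hw : ∑ b, tinner (hslice A b) (hslice A b) / tinner A A = 1 := by
    rw [← Finset.sum_div, sum_tinner_hslice, div_self (tinner_self_pos hA).ne']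
  have hZ : ∀ (a : Fin N₂) (b : Fin N₁) (s : State N₁ N₂ K N₃),
      (step A B lam αc αr a b s).Z = (step A B lam αc αr a b₀ s).Z := fun _ _ _ => rfl
  congr 1
  funext ω
  refine Finset.sum_congr rfl fun a _ => ?_
  rw [Finset.sum_congr rfl fun b _ => by rw [hZ a b], ← Finset.sum_mul, hw, one_mul]

variable [NeZero N₃]

theorem IsPicks.integral_zErr_le {A : Tensor N₁ N₂ N₃} (hA : A ≠ 0) (h : IsPicks A μ j i)
    {B : Tensor N₁ K N₃} {Xh : Tensor N₂ K N₃} (hXh : IsFeasible A B Xh) (Y₀ : Tensor N₂ K N₃)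
    (hαc : 0 ≤ 2 * αc - αc ^ 2 * lamC A) (b₀ : Fin N₁) (k : ℕ) :
    ∫ ω, tinner (zErr A B Xh (run A B lam αc αr Y₀ j i (k + 1) ω).Z)
        (zErr A B Xh (run A B lam αc αr Y₀ j i (k + 1) ω).Z) ∂μ ≤
      rhoC A αc * ∫ ω, tinner (zErr A B Xh (run A B lam αc αr Y₀ j i k ω).Z)
        (zErr A B Xh (run A B lam αc αr Y₀ j i k ω).Z) ∂μ := by
  rw [h.integral_zErr_run_succ hA B Xh Y₀ b₀ k, ← integral_const_mul]
  refine integral_mono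
    (h.integrable_run B Y₀ (fun s => ∑ a, tinner (lslice A a) (lslice A a) / tinner A A *
      tinner (zErr A B Xh (step A B lam αc αr a b₀ s).Z)
        (zErr A B Xh (step A B lam αc αr a b₀ s).Z)) k)
    ((h.integrable_run B Y₀ (fun s => tinner (zErr A B Xh s.Z) (zErr A B Xh s.Z)) k).const_mul _)
    fun ω => ?_
  exact sum_tinner_zErr_step_le hA hXh hαc b₀ (zErr_run_mem_rangeK hXh Y₀ j i k ω)

theorem IsPicks.integral_bregErr_le {A : Tensor N₁ N₂ N₃} (hA : A ≠ 0) (h : IsPicks A μ j i)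
    (hlam : 0 ≤ lam) (B : Tensor N₁ K N₃) {Xh Y₀ : Tensor N₂ K N₃}
    (hY₀ : Y₀ ∈ rangeK K (ttrans A)) {ν : ℝ} (hν : 0 < ν)
    (hEB : ErrorBound A (sparseObj lam) Xh ν) (hαr : 0 ≤ 2 * αr - αr ^ 2 * lamR A)
    {δ : ℝ} (hδ : 0 < δ) (b₀ : Fin N₁) (k : ℕ) :
    ∫ ω, bregErr A B lam αc αr Y₀ Xh j i (k + 1) ω ∂μ ≤
      (1 + δ) * rhoR A αr ν * ∫ ω, bregErr A B lam αc αr Y₀ Xh j i k ω ∂μ +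
        (δ + 1) / (2 * δ) * (αr ^ 2 * lamR A / tinner A A) *
          ∫ ω, tinner (zErr A B Xh (run A B lam αc αr Y₀ j i (k + 1) ω).Z)
            (zErr A B Xh (run A B lam αc αr Y₀ j i (k + 1) ω).Z) ∂μ := by
  have hw : ∑ a, tinner (lslice A a) (lslice A a) / tinner A A = 1 := by
    rw [← Finset.sum_div, sum_tinner_lslice, div_self (tinner_self_pos hA).ne']
  rw [h.integral_zErr_run_succ hA B Xh Y₀ b₀ k,
    show ∫ ω, bregErr A B lam αc αr Y₀ Xh j i (k + 1) ω ∂μ = _ from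
      h.integral_run_succ B Y₀ (fun s => bregman (sparseObj lam) s.Y s.X Xh) k,
    ← integral_const_mul, ← integral_const_mul]
  have hi1 : Integrable (fun ω => (1 + δ) * rhoR A αr ν *
      bregErr A B lam αc αr Y₀ Xh j i k ω) μ :=
    (h.integrable_run B Y₀ (fun s => bregman (sparseObj lam) s.Y s.X Xh) k).const_mul _
  have hi2 := (h.integrable_run (lam := lam) (αc := αc) (αr := αr) B Y₀
    (fun s => ∑ a, tinner (lslice A a) (lslice A a) / tinner A A *
      tinner (zErr A B Xh (step A B lam αc αr a b₀ s).Z)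
        (zErr A B Xh (step A B lam αc αr a b₀ s).Z)) k).const_mul
      ((δ + 1) / (2 * δ) * (αr ^ 2 * lamR A / tinner A A))
  rw [← integral_add hi1 hi2]
  refine integral_mono
    (h.integrable_run B Y₀ (fun s => ∑ a, tinner (lslice A a) (lslice A a) / tinner A A *
      ∑ b, tinner (hslice A b) (hslice A b) / tinner A A *
        bregman (sparseObj lam) (step A B lam αc αr a b s).Y (step A B lam αc αr a b s).X Xh) k)
    (hi1.add hi2) fun ω => ?_
  set s := run A B lam αc αr Y₀ j i k ω
  calc _ ≤ ∑ a, tinner (lslice A a) (lslice A a) / tinner A A *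
          ((1 + δ) * rhoR A αr ν * bregman (sparseObj lam) s.Y s.X Xh +
            (δ + 1) / (2 * δ) * (αr ^ 2 * lamR A / tinner A A) *
              tinner (zErr A B Xh (step A B lam αc αr a b₀ s).Z)
                (zErr A B Xh (step A B lam αc αr a b₀ s).Z)) :=
        Finset.sum_le_sum fun a _ => mul_le_mul_of_nonneg_left
          (sum_bregman_step_le hlam hA hν hEB hαr hδ a b₀
            (run_Y_mem_subdiff hlam A B Y₀ j i k ω) (run_Y_mem_rangeK hY₀ j i k ω))
          (div_nonneg (tinner_self_nonneg _) (tinner_self_nonneg _))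
    _ = _ := by
        simp only [mul_add, Finset.sum_add_distrib]
        rw [← Finset.sum_mul, hw, one_mul, Finset.mul_sum]
        congr 1
        exact Finset.sum_congr rfl fun a _ => by ring

/-- The bound on the expected Bregman distance, when the rate `rhoR` is nonnegative. -/
theorem IsPicks.integral_bregErr_le_sum {A : Tensor N₁ N₂ N₃} (hA : A ≠ 0) (h : IsPicks A μ j i)
    (hlam : 0 ≤ lam) {B : Tensor N₁ K N₃} {Xh Y₀ : Tensor N₂ K N₃} (hXh : IsFeasible A B Xh)
    (hY₀ : Y₀ ∈ rangeK K (ttrans A)) {ν : ℝ} (hν : 0 < ν)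
    (hEB : ErrorBound A (sparseObj lam) Xh ν) (hαc : 0 ≤ 2 * αc - αc ^ 2 * lamC A)
    (hαr : 0 ≤ 2 * αr - αr ^ 2 * lamR A) (hρ : 0 ≤ rhoR A αr ν)
    {δ : ℝ} (hδ : 0 < δ) (k : ℕ) :
    ∫ ω, bregErr A B lam αc αr Y₀ Xh j i k ω ∂μ ≤
      (δ + 1) / (2 * δ) * resConst A B αr *
          ∑ l ∈ Finset.range k, rhoC A αc ^ (k - l) * (1 + δ) ^ l * rhoR A αr ν ^ l
        + (1 + δ) ^ k * rhoR A αr ν ^ k *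
          bregman (sparseObj lam) Y₀ (softShrink lam Y₀) Xh := by
  have hne : Nonempty (Fin N₁) := by
    by_contra hempty
    rw [not_nonempty_iff] at hempty
    exact hA (Subsingleton.elim _ _)
  obtain ⟨b₀⟩ := hne
  have hlamR : 0 ≤ lamR A := Real.iSup_nonneg fun i => by positivity
  have hF := tinner_self_pos hA
  have hmain := le_of_linear_recursion
    (d := fun k => ∫ ω, bregErr A B lam αc αr Y₀ Xh j i k ω ∂μ)
    (e := fun k => ∫ ω, tinner (zErr A B Xh (run A B lam αc αr Y₀ j i k ω).Z)
      (zErr A B Xh (run A B lam αc αr Y₀ j i k ω).Z) ∂μ)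
    (q := (1 + δ) * rhoR A αr ν) (r := rhoC A αc)
    (c := (δ + 1) / (2 * δ) * (αr ^ 2 * lamR A / tinner A A))
    (by positivity) (by positivity) (rhoC_nonneg hA hαc)
    (h.integral_zErr_le hA hXh Y₀ hαc b₀)
    (h.integral_bregErr_le hA hlam B hY₀ hν hEB hαr hδ b₀) k
  have hd0 : ∫ ω, bregErr A B lam αc αr Y₀ Xh j i 0 ω ∂μ =
      bregman (sparseObj lam) Y₀ (softShrink lam Y₀) Xh := by
    have : ∀ ω, bregErr A B lam αc αr Y₀ Xh j i 0 ω =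
        bregman (sparseObj lam) Y₀ (softShrink lam Y₀) Xh := fun _ => rfl
    simp [this]
  have he0 : ∫ ω, tinner (zErr A B Xh (run A B lam αc αr Y₀ j i 0 ω).Z)
      (zErr A B Xh (run A B lam αc αr Y₀ j i 0 ω).Z) ∂μ = tinner (tmul A Xh) (tmul A Xh) := by
    simp [zErr_run_zero]
  rw [hd0, he0, hXh.tmul_eq] at hmain
  simp only [mul_pow, ← mul_assoc] at hmain
  rw [resConst, frobNorm_sq, frobNorm_sq]
  simpa only [mul_assoc] using hmain

/-- If shrinkage maps the whole range of `Aᵀ` to `Xh`, then the iterates are at the solution from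
the start, and `A * A† * B = A * Xh` vanishes, as `Xh` is the shrinkage of `0`. -/
theorem resConst_eq_zero_of_softShrink_eq {A : Tensor N₁ N₂ N₃}
    {B : Tensor N₁ K N₃} {Xh : Tensor N₂ K N₃} (hXh : IsFeasible A B Xh)
    (hall : ∀ Z ∈ rangeK K (ttrans A), softShrink lam Z = Xh) : resConst A B αr = 0 := by
  have h0 : Xh = 0 := by
    rw [← hall 0 (zero_mem_rangeK _)]
    funext a b c
    simp [softShrink]
  rw [resConst, ← hXh.tmul_eq, frobNorm_sq (tmul A Xh), h0, tmul_zero, tinner_zero_left, mul_zero]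

end Expectation

end TensorRecovery

end

open TensorRecovery

/-- Linear convergence in expectation of the randomized regularized extended Kaczmarz algorithm
with soft shrinkage for sparse tensor recovery. -/
theorem corollary4p2 {N₁ N₂ K N₃ : ℕ} (A : Tensor N₁ N₂ N₃) (hA : A ≠ 0)
    (B : Tensor N₁ K N₃) (lam : ℝ) (hlam : 0 ≤ lam) :
    -- the problem has a unique solution
    (∃! Xh : Tensor N₂ K N₃, IsSparseSolution A B lam Xh) ∧
    ∀ Xh : Tensor N₂ K N₃, IsSparseSolution A B lam Xh →
      -- an error bound holds with some positive constant
      (∃ ν : ℝ, 0 < ν ∧ ErrorBound A (sparseObj lam) Xh ν) ∧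
      -- and, for every such constant and all admissible step sizes, the algorithm converges
      ∀ ν : ℝ, 0 < ν → ErrorBound A (sparseObj lam) Xh ν →
      ∀ αc αr : ℝ, 0 < αc → αc < 2 / lamC A → 0 < αr → αr < 2 / lamR A →
      ∀ Y₀ ∈ rangeK K (ttrans A),
      ∀ (Ω : Type*) [MeasurableSpace Ω] (μ : Measure Ω) [IsProbabilityMeasure μ]
        (j : ℕ → Ω → Fin N₂) (i : ℕ → Ω → Fin N₁), IsPicks A μ j i →
      -- the Bregman distances are well defined, and the expectations exist
      (∀ k ω, (run A B lam αc αr Y₀ j i k ω).Y ∈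
        subdiff (sparseObj lam) (run A B lam αc αr Y₀ j i k ω).X) ∧
      (∀ k, Integrable (bregErr A B lam αc αr Y₀ Xh j i k) μ) ∧
      (∀ k, Integrable (fun ω => frobNorm ((run A B lam αc αr Y₀ j i k ω).X - Xh) ^ 2) μ) ∧
      -- the bound
      (∀ δ : ℝ, 0 < δ → ∀ k : ℕ,
        ∫ ω, bregErr A B lam αc αr Y₀ Xh j i k ω ∂μ ≤
          (δ + 1) / (2 * δ) * resConst A B αr *
              ∑ l ∈ Finset.range k, rhoC A αc ^ (k - l) * (1 + δ) ^ l * rhoR A αr ν ^ l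
            + (1 + δ) ^ k * rhoR A αr ν ^ k *
              bregman (sparseObj lam) Y₀ (softShrink lam Y₀) Xh) ∧
      -- linear convergence in expectation to the solution
      0 ≤ max (rhoC A αc) (rhoR A αr ν) ∧ max (rhoC A αc) (rhoR A αr ν) < 1 ∧
      (∀ δ : ℝ, 0 < δ → ∀ k : ℕ,
        ∫ ω, bregErr A B lam αc αr Y₀ Xh j i k ω ∂μ ≤
          (1 + δ) ^ k * max (rhoC A αc) (rhoR A αr ν) ^ k *
            (bregman (sparseObj lam) Y₀ (softShrink lam Y₀) Xh
              + (δ + 1) / (2 * δ ^ 2) * resConst A B αr)) ∧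
      (∀ δ : ℝ, 0 < δ → ∀ k : ℕ,
        ∫ ω, frobNorm ((run A B lam αc αr Y₀ j i k ω).X - Xh) ^ 2 ∂μ ≤
          (1 + δ) ^ k * max (rhoC A αc) (rhoR A αr ν) ^ k *
            (2 * (bregman (sparseObj lam) Y₀ (softShrink lam Y₀) Xh
              + (δ + 1) / (2 * δ ^ 2) * resConst A B αr))) := by
  have hN₃ : NeZero N₃ := by
    refine ⟨fun h => hA ?_⟩
    subst h
    funext _ _ k
    exact k.elim0
  obtain ⟨X, hX⟩ := exists_isSparseSolution A B hlam
  refine ⟨⟨X, hX, fun Y hY => hX.unique hlam hY⟩, fun Xh hXh => ⟨?_, ?_⟩⟩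
  · obtain ⟨W, hWR, hW⟩ := hXh.exists_mem_subdiff hlam
    exact exists_errorBound hlam A hWR hW
  intro ν hν hEB αc αr hαc0 hαc1 hαr0 hαr1 Y₀ hY₀ Ω _ μ _ j i h
  have hαc := step_size_pos hαc0 hαc1
  have hαr := step_size_pos hαr0 hαr1
  have hmem := run_Y_mem_subdiff (αc := αc) (αr := αr) hlam A B Y₀ j i
  have hint1 : ∀ k, Integrable (bregErr A B lam αc αr Y₀ Xh j i k) μ := fun k =>
    h.integrable_run B Y₀ (fun s => bregman (sparseObj lam) s.Y s.X Xh) k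
  have hint2 : ∀ k, Integrable
      (fun ω => frobNorm ((run A B lam αc αr Y₀ j i k ω).X - Xh) ^ 2) μ := fun k =>
    h.integrable_run B Y₀ (fun s => frobNorm (s.X - Xh) ^ 2) k
  have hρc0 := rhoC_nonneg hA hαc.le
  have hρ0 : 0 ≤ max (rhoC A αc) (rhoR A αr ν) := hρc0.trans (le_max_left _ _)
  have hD₀ : 0 ≤ bregman (sparseObj lam) Y₀ (softShrink lam Y₀) Xh :=
    le_trans (mul_nonneg (by norm_num) (tinner_self_nonneg _))
      (half_tinner_le_bregman hlam (mem_subdiff_softShrink hlam Y₀) Xh)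
  have hlamR : 0 ≤ lamR A := Real.iSup_nonneg fun i => by positivity
  have hres : 0 ≤ resConst A B αr := by
    unfold resConst
    positivity
  -- The rate `rhoR` can be negative only if every subgradient in the range of `Aᵀ` belongs to the
  -- solution, in which case all quantities vanish.
  have hbounds : ∀ δ : ℝ, 0 < δ → ∀ k : ℕ,
      ∫ ω, bregErr A B lam αc αr Y₀ Xh j i k ω ∂μ ≤
          (δ + 1) / (2 * δ) * resConst A B αr *
              ∑ l ∈ Finset.range k, rhoC A αc ^ (k - l) * (1 + δ) ^ l * rhoR A αr ν ^ l
            + (1 + δ) ^ k * rhoR A αr ν ^ k *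
              bregman (sparseObj lam) Y₀ (softShrink lam Y₀) Xh ∧
      ∫ ω, bregErr A B lam αc αr Y₀ Xh j i k ω ∂μ ≤
          (1 + δ) ^ k * max (rhoC A αc) (rhoR A αr ν) ^ k *
            (bregman (sparseObj lam) Y₀ (softShrink lam Y₀) Xh
              + (δ + 1) / (2 * δ ^ 2) * resConst A B αr) := by
    intro δ hδ k
    by_cases hall : ∀ Z ∈ rangeK K (ttrans A), softShrink lam Z = Xh
    · have hbreg : ∀ Z, bregman (sparseObj lam) Z Xh Xh = 0 := fun Z => by simp [bregman]
      have h1 : ∀ ω, bregErr A B lam αc αr Y₀ Xh j i k ω = 0 := fun ω => by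
        rw [bregErr, run_X_eq, hall _ (run_Y_mem_rangeK hY₀ j i k ω), hbreg]
      rw [hall Y₀ hY₀, hbreg, resConst_eq_zero_of_softShrink_eq hXh.1 hall]
      simp [h1]
    · push Not at hall
      obtain ⟨Z, hZ, hne⟩ := hall
      have hρr0 := rhoR_nonneg hA hlam hν hαr.le hEB hZ hne
      have hmain := h.integral_bregErr_le_sum hA hlam hXh.1 hY₀ hν hEB hαc.le hαr.le hρr0 hδ k
      refine ⟨hmain, hmain.trans ?_⟩
      have hs := sum_rates_le hρc0 hρr0 hδ k
      have hpow : rhoR A αr ν ^ k ≤ max (rhoC A αc) (rhoR A αr ν) ^ k :=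
        pow_le_pow_left₀ hρr0 (le_max_right _ _) k
      calc _ ≤ (δ + 1) / (2 * δ) * resConst A B αr *
              ((1 + δ) ^ k * max (rhoC A αc) (rhoR A αr ν) ^ k * (1 / δ)) +
            (1 + δ) ^ k * max (rhoC A αc) (rhoR A αr ν) ^ k *
              bregman (sparseObj lam) Y₀ (softShrink lam Y₀) Xh := by
            gcongr
        _ = _ := by
            field_simp
            ring
  refine ⟨hmem, hint1, hint2, fun δ hδ k => (hbounds δ hδ k).1, hρ0,
    max_lt (rhoC_lt_one hA hαc) (rhoR_lt_one hA hν hαr), fun δ hδ k => (hbounds δ hδ k).2,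
    fun δ hδ k => ?_⟩
  calc ∫ ω, frobNorm ((run A B lam αc αr Y₀ j i k ω).X - Xh) ^ 2 ∂μ ≤
        ∫ ω, 2 * bregErr A B lam αc αr Y₀ Xh j i k ω ∂μ := by
        refine integral_mono (hint2 k) ((hint1 k).const_mul 2) fun ω => ?_
        have := half_tinner_le_bregman hlam (hmem k ω) Xh
        simp only [frobNorm_sq, bregErr]
        linarith
    _ = 2 * ∫ ω, bregErr A B lam αc αr Y₀ Xh j i k ω ∂μ := integral_const_mul _ _
    _ ≤ _ := by
        have := (hbounds δ hδ k).2
        linarith
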